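/- **Theorem (exponential stabilization).** Let $a\in C([0,1])\cap C^1((0,1])$ satisfy $a(0)=0$, $a>0$ on $(0,1]$, $$\mu_a:=\sup_{0<x\le 1}\frac{x|a'(x)|}{a(x)}<2,$$ and $a\in C^{[\mu_a]}([0,1])$, where $[\cdot]$ is the integer part. Let $\beta>0$. *Spaces.* Let $V^1_a$ be the space of all $u\in L^2(0,1)$ that are locally absolutely continuous in $(0,1]$ with $\sqrt a\,u'\in L^2(0,1)$, and $V^2_a=\{u\in V^1_a: au'\in H^1(0,1)\}$. Let $W^1_a=V^1_a$ if $\mu_a\in[1,2)$ and $W^1_a=\{u\in V^1_a:u(0)=0\}$ if $\mu_a\in[0,1)$; let $W^2_a=V^2_a\cap W^1_a$. Let $\mathcal H_\beta=W^1_a\times L^2(0,1)$ with $$\|(u,v)\|^2_{\mathcal H_\beta}=\int_0^1\big(v^2+a\,(u')^2\big)\,dx+a(1)\beta\,u(1)^2 ,$$ and let $A_\beta(u,v)=(v,(au')')$ with domain $D(A_\beta)=\{(u,v)\in W^2_a\times W^1_a:\ u'(1)+v(1)+\beta u(1)=0\}$. *Solutions.* Consider the degenerate wave equation $$u_{tt}-(a(x)u_x)_x=0\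 \text{ in }(0,\infty)\times(0,1),\qquad u_t(t,1)+u_x(t,1)+\beta u(t,1)=0,$$ with $u(t,0)=0$ if $\mu_a\in[0,1)$ and $\lim_{x\downarrow0}a(x)u_x(t,x)=0$ if $\mu_a\in[1,2)$, and with initial data $(u,u_t)(0,\cdot)=(u_0,u_1)\in\mathcal H_\beta$. Its (mild) solution is $U=(u,u_t)\in C([0,\infty);\mathcal H_\beta)$, $U(t)=e^{tA_\beta}(u_0,u_1)$, that is, for all $t\ge 0$, $\int_0^tU(s)\,ds\in D(A_\beta)$ and $U(t)=(u_0,u_1)+A_\beta\int_0^tU(s)\,ds$. Its energy is $$E_u(t)=\tfrac12\Big[\int_0^1\big(u_t^2(t,x)+a(x)u_x^2(t,x)\big)\,dx+\beta a(1)u^2(t,1)\Big].$$ *Constants.* Put $$C_a'=\frac1{a(1)}\min\Big\{4,\frac2{2-\mu_a}\Big\},\quad \alpha_a=\min\Big\{\frac1{C_a'},\frac{\beta a(1)}2\Big\},\quad C_a''=2\max\Big\{1+\frac{\mu_a}4,\ \frac1{a(1)}+\frac{\mu_a}4C_a',\ \frac{\mu_a}{2\beta a(1)}\Big\},$$ $$\eta_1=1+\tfrac32a(1),\qquad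 \eta_2=\beta(1+\beta-\mu_a)+\tfrac12\Big(2\beta-\frac{\mu_a}2\Big)^2,$$ $$M_{a,\beta}=\frac2{2-\mu_a}\Big[2C_a''+\frac{\eta_1}{a(1)}+\frac{\eta_2^2\,(1+\beta^{-3})}{2-\mu_a}\Big(1+\frac1{\beta\alpha_a}\Big)+\frac{2\eta_2}{\beta\sqrt{\alpha_a}}\Big].$$ *Conclusion.* $M_{a,\beta}>0$, and for all $(u_0,u_1)\in\mathcal H_\beta$ every mild solution $u$ of the above problem satisfies $$E_u(t)\le E_u(0)\,e^{\,1-t/M_{a,\beta}}\qquad\text{for all } t\in[M_{a,\beta},+\infty).$$ -/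

import Mathlib

open MeasureTheory Set Filter Topology

noncomputable section

namespace DegenerateWave

/-! ### The spatial derivative and Lebesgue spaces on the unit interval -/

/-- The classical derivative on `(0,1]`: the usual derivative at interior points and the left
derivative at `1`.  A locally absolutely continuous function on `(0,1]` has this derivative at
almost every point, and it is then its weak derivative. -/
def D (f : ℝ → ℝ) (x : ℝ) : ℝ := derivWithin f (Ioc 0 1) x

/-- `f ∈ L²(0,1)`. -/
def MemL2 (f : ℝ → ℝ) : Prop := MemLp f 2 (volume.restrict (Ioo (0 : ℝ) 1))

/-- Equality almost everywhere on `(0,1)`. -/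
def EqAE (f g : ℝ → ℝ) : Prop := f =ᵐ[volume.restrict (Ioo (0 : ℝ) 1)] g

/-! ### The diffusion coefficient -/

/-- `μ_a = sup_{0 < x ≤ 1} x |a'(x)| / a(x)` (a genuine supremum as soon as the set is bounded
above, which is part of `Admissible`). -/
def muA (a : ℝ → ℝ) : ℝ := sSup ((fun x => x * |D a x| / a x) '' Ioc 0 1)

/-- The standing assumptions on the coefficient `a`: it belongs to `C([0,1]) ∩ C¹((0,1])`, is
positive on `(0,1]`, vanishes at `0`, satisfies `μ_a < 2` (in particular `μ_a` is finite) and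
belongs to `C^{[μ_a]}([0,1])`. -/
structure Admissible (a : ℝ → ℝ) : Prop where
  continuousOn : ContinuousOn a (Icc 0 1)
  contDiffOn : ContDiffOn ℝ 1 a (Ioc 0 1)
  pos : ∀ x ∈ Ioc (0 : ℝ) 1, 0 < a x
  zero : a 0 = 0
  bddAbove : BddAbove ((fun x => x * |D a x| / a x) '' Ioc 0 1)
  mu_lt_two : muA a < 2
  contDiffOn_floor : ContDiffOn ℝ (⌊muA a⌋₊ : ℕ) a (Icc 0 1)

/-! ### Weighted Sobolev spaces

Elements of the spaces are represented by functions `ℝ → ℝ`, of which only the restriction to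
`(0,1]` matters.  For members of `V¹_a` the function is the locally absolutely continuous
representative, so that the value `f 1` is the trace at `1`. -/

/-- `V¹_a(0,1)`. -/
structure MemV1 (a f : ℝ → ℝ) : Prop where
  memL2 : MemL2 f
  locallyAC : ∀ c ∈ Ioo (0 : ℝ) 1, AbsolutelyContinuousOnInterval f c 1
  deriv_memL2 : MemL2 (fun x => √(a x) * D f x)

/-- `H¹(0,1)`: functions which agree almost everywhere with an absolutely continuous function
on `[0,1]` whose derivative is in `L²(0,1)`. -/
def MemH1 (f : ℝ → ℝ) : Prop :=
  ∃ w : ℝ → ℝ, AbsolutelyContinuousOnInterval w 0 1 ∧ MemL2 (D w) ∧ EqAE f w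

/-- `V²_a(0,1) = {f ∈ V¹_a(0,1) : a f' ∈ H¹(0,1)}`. -/
def MemV2 (a f : ℝ → ℝ) : Prop := MemV1 a f ∧ MemH1 (fun x => a x * D f x)

/-- `W¹_a(0,1)`: all of `V¹_a(0,1)` if `μ_a ∈ [1,2)`, with the additional condition `f(0) = 0`
(the value at `0` of the continuous extension) if `μ_a ∈ [0,1)`. -/
def MemW1 (a f : ℝ → ℝ) : Prop := MemV1 a f ∧ (muA a < 1 → Tendsto f (𝓝[>] 0) (𝓝 0))

/-- `W²_a(0,1) = V²_a(0,1) ∩ W¹_a(0,1)`. -/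
def MemW2 (a f : ℝ → ℝ) : Prop := MemV2 a f ∧ MemW1 a f

/-! ### The energy space and the generator -/

/-- Pairs `(u, v)` of functions on `(0,1]`. -/
abbrev State : Type := (ℝ → ℝ) × (ℝ → ℝ)

/-- `ℋ_β = W¹_a(0,1) × L²(0,1)`. -/
def MemH (a : ℝ → ℝ) (U : State) : Prop := MemW1 a U.1 ∧ MemL2 U.2

/-- The squared norm of `ℋ_β`,
`‖(u,v)‖² = ∫₀¹ (v² + a (u')²) dx + a(1) β u(1)²`. -/
def normSqH (a : ℝ → ℝ) (β : ℝ) (U : State) : ℝ :=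
  (∫ x in (0 : ℝ)..1, (U.2 x ^ 2 + a x * D U.1 x ^ 2)) + a 1 * β * U.1 1 ^ 2

/-- The domain
`D(A_β) = {(u,v) ∈ W²_a(0,1) × W¹_a(0,1) : u'(1) + v(1) + β u(1) = 0}`. -/
def MemDomain (a : ℝ → ℝ) (β : ℝ) (U : State) : Prop :=
  MemW2 a U.1 ∧ MemW1 a U.2 ∧ D U.1 1 + U.2 1 + β * U.1 1 = 0

/-- The operator `A_β (u,v) = (v, (a u')')`. -/
def opA (a : ℝ → ℝ) (U : State) : State := (U.2, D (fun x => a x * D U.1 x))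

/-- Equality of two elements of `ℋ_β`. -/
def EqH (U V : State) : Prop := EqAE U.1 V.1 ∧ EqAE U.2 V.2

/-- Continuity on `[0,∞)` of a curve in `ℋ_β`, for the norm of `ℋ_β`. -/
def ContinuousH (a : ℝ → ℝ) (β : ℝ) (U : ℝ → State) : Prop :=
  ∀ t, 0 ≤ t → Tendsto (fun s => normSqH a β (U s - U t)) (𝓝[Ici 0] t) (𝓝 0)

/-- The curve `P` in `ℋ_β` is differentiable on `[0,∞)`, for the norm of `ℋ_β`, with
derivative `U` (one-sided at time `0`). -/
def HasDerivH (a : ℝ → ℝ) (β : ℝ) (P U : ℝ → State) : Prop :=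
  ∀ t, 0 ≤ t →
    Tendsto (fun s => normSqH a β ((s - t)⁻¹ • (P s - P t) - U t)) (𝓝[Ici 0 \ {t}] t) (𝓝 0)

/-- `U` is the mild solution `U(t) = e^{t A_β} U₀` of `U' = A_β U`, `U(0) = U₀`, in `ℋ_β`:
`U ∈ C([0,∞); ℋ_β)` and, for all `t ≥ 0`, `∫₀ᵗ U(s) ds ∈ D(A_β)` and
`U(t) = U₀ + A_β ∫₀ᵗ U(s) ds`.  The integral enters as the curve `P`, the `C¹` primitive of `U`
in `ℋ_β` that vanishes at time `0`.  Writing `U(t) = (u(t), v(t))`, the first component of the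
identity says that `u(t) = u₀ + ∫₀ᵗ v(s) ds`, i.e. `v = u_t` as `L²(0,1)`-valued functions. -/
def IsMildSolution (a : ℝ → ℝ) (β : ℝ) (U₀ : State) (U : ℝ → State) : Prop :=
  (∀ t, 0 ≤ t → MemH a (U t)) ∧ ContinuousH a β U ∧
    ∃ P : ℝ → State, P 0 = 0 ∧ HasDerivH a β P U ∧
      ∀ t, 0 ≤ t → MemDomain a β (P t) ∧ EqH (U t - U₀) (opA a (P t))

/-- The energy `E_u(t) = ½ [∫₀¹ (u_t² + a u_x²) dx + β a(1) u(t,1)²]` of `U = (u, u_t)`. -/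
def energy (a : ℝ → ℝ) (β : ℝ) (U : ℝ → State) (t : ℝ) : ℝ :=
  1 / 2 * ((∫ x in (0 : ℝ)..1, ((U t).2 x ^ 2 + a x * D (U t).1 x ^ 2))
    + β * a 1 * (U t).1 1 ^ 2)

/-! ### The explicit decay time -/

/-- `C'_a = (1/a(1)) min {4, 2/(2-μ_a)}`. -/
def constC' (a : ℝ → ℝ) : ℝ := 1 / a 1 * min 4 (2 / (2 - muA a))

/-- `α_a = min {1/C'_a, β a(1)/2}`. -/
def constAlpha (a : ℝ → ℝ) (β : ℝ) : ℝ := min (1 / constC' a) (β * a 1 / 2)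

/-- `C''_a = 2 max {1 + μ_a/4, 1/a(1) + (μ_a/4) C'_a, μ_a/(2 β a(1))}`. -/
def constC'' (a : ℝ → ℝ) (β : ℝ) : ℝ :=
  2 * max (1 + muA a / 4)
    (max (1 / a 1 + muA a / 4 * constC' a) (muA a / (2 * β * a 1)))

/-- `η₁ = 1 + (3/2) a(1)`. -/
def constEta1 (a : ℝ → ℝ) : ℝ := 1 + 3 / 2 * a 1

/-- `η₂ = β (1 + β - μ_a) + ½ (2β - μ_a/2)²`. -/
def constEta2 (a : ℝ → ℝ) (β : ℝ) : ℝ :=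
  β * (1 + β - muA a) + 1 / 2 * (2 * β - muA a / 2) ^ 2

/-- The decay time `M_{a,β}`. -/
def constM (a : ℝ → ℝ) (β : ℝ) : ℝ :=
  2 / (2 - muA a) *
    (2 * constC'' a β + constEta1 a / a 1
      + constEta2 a β ^ 2 * (1 + 1 / β ^ 3) / (2 - muA a) * (1 + 1 / (β * constAlpha a β))
      + 2 * constEta2 a β / (β * √(constAlpha a β)))

end DegenerateWave

end

noncomputable section

namespace DegenerateWave

/-! Suppose first that the solution is classical, with state $(u,v)$. Green's formula (`green`) and
the boundary condition give $E'=-a(1)v(1)^2$. The multiplier functional $F=2\int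
xu'v+\frac{\mu_a}{2}\int uv$ is bounded by $C_a''E$, and `multiplier_rate` yields
$F'\le\eta_1v(1)^2+a(1)\eta_2u(1)^2-(2-\mu_a)E$. The bound $x|a'|\le\mu_a a$ with $\mu_a<2$ makes
the last coefficient negative.

The term in $v(1)^2$ is dissipated; the one in $u(1)^2$ is not. If $\eta_2<0$ it is dropped.
Otherwise a fixed corrector $\zeta$ (`exists_corrector`) represents the trace: $\int au'\zeta'+\beta
a(1)u(1)\zeta(1)=u(1)$ on $W^1_a$. The derivative of $u(1)\int v\zeta$ then contains $-u(1)^2$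
(`corrector_rate`), so adding $a(1)\eta_2\,u(1)\int v\zeta$ to $F$ cancels the bad term. The
remainder carries a factor $v(1)$ and costs half of the decay rate plus a multiple of the
dissipation (`corrector_remainder_le`).

What remains has the form $F'\le K\,a(1)v(1)^2-\kappa E$ and $|F|\le cE$. Integration gives
$\int_s^TE\le\kappa^{-1}(2c+K)E(s)\le M_{a,\beta}E(s)$, and such an integral inequality forces
exponential decay (`exp_decay_of_lyapunov`, `exp_decay_of_integral_le`).

For a mild solution with primitive $P$, the averages $h^{-1}(P(t+h)-P(t))$ are classical solutions
(`isClassicalSolution_average`) and converge to $U(t)$ in $\mathcal H_\beta$ as $h\downarrow0$, so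
the estimate passes to the limit. -/

/-- Lebesgue measure on `(0,1)`. -/
abbrev unitMeas : Measure ℝ := volume.restrict (Ioo (0 : ℝ) 1)

/-! ### Locally absolutely continuous functions and boundary terms at the degenerate endpoint. -/

/-- Local absolute continuity on `(0,1]`. -/
def LocAC (f : ℝ → ℝ) : Prop := ∀ c ∈ Ioo (0 : ℝ) 1, AbsolutelyContinuousOnInterval f c 1

lemma ae_unitMeas_mem : ∀ᵐ x ∂unitMeas, x ∈ Ioo (0 : ℝ) 1 :=
  ae_restrict_mem measurableSet_Ioo

lemma intervalIntegral_eq_unitMeas (f : ℝ → ℝ) :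
    ∫ x in (0 : ℝ)..1, f x = ∫ x, f x ∂unitMeas := by
  rw [intervalIntegral.integral_of_le zero_le_one, integral_Ioc_eq_integral_Ioo]

lemma Ioc_mem_nhds {x : ℝ} (hx : x ∈ Ioo (0 : ℝ) 1) : Ioc (0 : ℝ) 1 ∈ 𝓝 x :=
  mem_of_superset (isOpen_Ioo.mem_nhds hx) Ioo_subset_Ioc_self

lemma D_eq_deriv (f : ℝ → ℝ) {x : ℝ} (hx : x ∈ Ioo (0 : ℝ) 1) : D f x = deriv f x :=
  derivWithin_of_mem_nhds (Ioc_mem_nhds hx)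

lemma uniqueDiffWithinAt_Ioc_unit {x : ℝ} (hx : x ∈ Ioc (0 : ℝ) 1) :
    UniqueDiffWithinAt ℝ (Ioc (0 : ℝ) 1) x := uniqueDiffOn_Ioc 0 1 x hx

lemma D_congr {f g : ℝ → ℝ} (h : EqOn f g (Ioc 0 1)) {x : ℝ} (hx : x ∈ Ioc (0 : ℝ) 1) :
    D f x = D g x := derivWithin_congr h (h hx)

namespace LocAC

variable {f g : ℝ → ℝ}

lemma sub (hf : LocAC f) (hg : LocAC g) : LocAC (fun x => f x - g x) :=
  fun c hc => (hf c hc).fun_sub (hg c hc)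

lemma mul (hf : LocAC f) (hg : LocAC g) : LocAC (fun x => f x * g x) :=
  fun c hc => (hf c hc).fun_mul (hg c hc)

lemma const_mul (k : ℝ) (hf : LocAC f) : LocAC (fun x => k * f x) :=
  fun c hc => (hf c hc).const_mul k

lemma uIcc_sub {c : ℝ} (hc : c ∈ Ioo (0 : ℝ) 1) : uIcc c 1 ⊆ Ioc 0 1 := by
  rw [uIcc_of_le hc.2.le]
  exact fun x hx => ⟨hc.1.trans_le hx.1, hx.2⟩

lemma of_contDiffOn (hf : ContDiffOn ℝ 1 f (Ioc 0 1)) : LocAC f :=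
  fun _ hc => (hf.mono (uIcc_sub hc)).absolutelyContinuousOnInterval

lemma of_ac (hf : AbsolutelyContinuousOnInterval f 0 1) : LocAC f := fun c hc => hf.mono (by
  rw [uIcc_of_le hc.2.le, uIcc_of_le zero_le_one]
  exact Icc_subset_Icc hc.1.le le_rfl)

lemma continuousOn (hf : LocAC f) : ContinuousOn f (Ioc 0 1) := by
  intro x hx
  have hc : x / 2 ∈ Ioo (0 : ℝ) 1 := ⟨by linarith [hx.1], by linarith [hx.1, hx.2]⟩
  have h := (hf _ hc).continuousOn
  rw [uIcc_of_le hc.2.le] at h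
  refine (h x ⟨by linarith [hx.1], hx.2⟩).mono_of_mem_nhdsWithin ?_
  have : Ioi (x / 2) ∈ 𝓝 x := Ioi_mem_nhds (by linarith [hx.1])
  filter_upwards [self_mem_nhdsWithin, mem_nhdsWithin_of_mem_nhds this] with y hy hy'
  exact ⟨le_of_lt hy', hy.2⟩

lemma aestronglyMeasurable (hf : LocAC f) : AEStronglyMeasurable f unitMeas :=
  (hf.continuousOn.mono Ioo_subset_Ioc_self).aestronglyMeasurable measurableSet_Ioo

lemma ae_hasDerivAt (hf : LocAC f) : ∀ᵐ x ∂unitMeas, HasDerivAt f (D f x) x := by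
  have h : ∀ n : ℕ, ∀ᵐ x : ℝ, x ∈ uIcc (1 / ((n : ℝ) + 2)) 1 → DifferentiableAt ℝ f x := fun n =>
    (hf _ ⟨by positivity, by
      rw [div_lt_one (by positivity)]; linarith [n.cast_nonneg (α := ℝ)]⟩).ae_differentiableAt
  rw [ae_restrict_iff' measurableSet_Ioo]
  filter_upwards [ae_all_iff.2 h] with x hx hx1
  obtain ⟨n, hn⟩ := exists_nat_one_div_lt hx1.1
  have hn' : 1 / ((n : ℝ) + 2) ≤ 1 / ((n : ℝ) + 1) := by
    gcongr
    norm_num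
  have hle : 1 / ((n : ℝ) + 2) ≤ x := hn'.trans hn.le
  have hd := hx n (by
    rw [uIcc_of_le (hle.trans hx1.2.le)]
    exact ⟨hle, hx1.2.le⟩)
  rw [D_eq_deriv f hx1]
  exact hd.hasDerivAt

lemma ae_D_mul (hf : LocAC f) (hg : LocAC g) :
    ∀ᵐ x ∂unitMeas, D (fun y => f y * g y) x = D f x * g x + f x * D g x := by
  filter_upwards [hf.ae_hasDerivAt, hg.ae_hasDerivAt, ae_unitMeas_mem] with x h1 h2 hx
  rw [D_eq_deriv _ hx, (h1.fun_mul h2).deriv]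

lemma ae_D_sub (hf : LocAC f) (hg : LocAC g) :
    ∀ᵐ x ∂unitMeas, D (fun y => f y - g y) x = D f x - D g x := by
  filter_upwards [hf.ae_hasDerivAt, hg.ae_hasDerivAt, ae_unitMeas_mem] with x h1 h2 hx
  rw [D_eq_deriv _ hx, (h1.fun_sub h2).deriv]

lemma ae_D_const_mul (k : ℝ) (hf : LocAC f) :
    ∀ᵐ x ∂unitMeas, D (fun y => k * f y) x = k * D f x := by
  filter_upwards [hf.ae_hasDerivAt, ae_unitMeas_mem] with x h1 hx
  rw [D_eq_deriv _ hx, (h1.const_mul k).deriv]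

lemma aestronglyMeasurable_D (f : ℝ → ℝ) : AEStronglyMeasurable (D f) unitMeas := by
  have h : AEStronglyMeasurable (deriv f) unitMeas :=
    (stronglyMeasurable_deriv f).aestronglyMeasurable
  refine h.congr ?_
  filter_upwards [ae_unitMeas_mem] with x hx
  exact (D_eq_deriv f hx).symm

lemma integral_eq_sub (hf : LocAC f) {G : ℝ → ℝ} (hG : ∀ᵐ x ∂unitMeas, D f x = G x)
    {c : ℝ} (hc : c ∈ Ioo (0 : ℝ) 1) : ∫ x in c..1, G x = f 1 - f c := by
  rw [← (hf c hc).integral_deriv_eq_sub]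
  apply intervalIntegral.integral_congr_ae
  rw [ae_restrict_iff' measurableSet_Ioo] at hG
  have h1 : ∀ᵐ x : ℝ, x ≠ 1 := by simp [ae_iff, measure_singleton]
  filter_upwards [hG, h1] with x hx hx1 hxc
  rw [uIoc_of_le hc.2.le] at hxc
  have hm : x ∈ Ioo (0 : ℝ) 1 := ⟨hc.1.trans hxc.1, lt_of_le_of_ne hxc.2 hx1⟩
  rw [← hx hm, D_eq_deriv f hm]

/-- A locally absolutely continuous function with integrable derivative has a limit at `0`. -/
lemma tendsto (hf : LocAC f) {G : ℝ → ℝ} (hG : ∀ᵐ x ∂unitMeas, D f x = G x)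
    (hGi : Integrable G unitMeas) : Tendsto f (𝓝[>] 0) (𝓝 (f 1 - ∫ x, G x ∂unitMeas)) := by
  have hi : IntegrableOn G (uIcc 0 1) := by
    rw [uIcc_of_le zero_le_one, integrableOn_Icc_iff_integrableOn_Ioo]
    exact hGi
  have hc := intervalIntegral.continuousOn_primitive_interval_left hi 0 (by simp)
  rw [uIcc_of_le zero_le_one] at hc
  have h2 : Tendsto (fun x => ∫ t in x..1, G t) (𝓝[>] 0) (𝓝 (∫ x, G x ∂unitMeas)) := by
    rw [← intervalIntegral_eq_unitMeas]
    have hc' : Tendsto (fun x => ∫ t in x..1, G t) (𝓝[Icc 0 1] 0) (𝓝 (∫ t in (0 : ℝ)..1, G t)) :=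
      hc
    have h3 := hc'.mono_left (nhdsWithin_mono 0 Ioo_subset_Icc_self)
    rwa [nhdsWithin_Ioo_eq_nhdsGT zero_lt_one] at h3
  refine (tendsto_const_nhds.sub h2).congr' ?_
  filter_upwards [Ioo_mem_nhdsGT (zero_lt_one (α := ℝ))] with x hx
  rw [hf.integral_eq_sub hG hx]
  ring

end LocAC

/-- If `F` has a limit at `0` and `|F x| ≤ x k(x)` with `k` integrable, the limit is `0`. -/
lemma limit_eq_zero_of_le {F k : ℝ → ℝ} {L : ℝ} (hF : Tendsto F (𝓝[>] 0) (𝓝 L))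
    (hk : Integrable k unitMeas) (hle : ∀ᵐ x ∂unitMeas, |F x| ≤ x * k x) : L = 0 := by
  by_contra hL
  have hL' : 0 < |L| := abs_pos.2 hL
  have h1 : ∀ᶠ x in 𝓝[>] (0 : ℝ), |L| / 2 < |F x| :=
    hF.abs.eventually (lt_mem_nhds (by linarith))
  obtain ⟨δ, hδ0, hδ⟩ := mem_nhdsGT_iff_exists_Ioo_subset.1 h1
  have hδ0' : (0 : ℝ) < δ := hδ0
  set ε := min δ 1 with hε
  have hε0 : 0 < ε := lt_min hδ0' one_pos
  have hsub : Ioo 0 ε ⊆ Ioo (0 : ℝ) 1 := Ioo_subset_Ioo le_rfl (min_le_right _ _)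
  have hk' : Integrable k (volume.restrict (Ioo 0 ε)) := hk.mono_measure
    (Measure.restrict_mono hsub le_rfl)
  have hle' : ∀ᵐ x ∂(volume.restrict (Ioo 0 ε)), |F x| ≤ x * k x :=
    ae_mono (Measure.restrict_mono hsub le_rfl) hle
  -- A nonzero limit would give $1/x\le(2/|L|)\,k(x)$ near $0$, making $1/x$ integrable there.
  have hinv : Integrable (fun x : ℝ => x⁻¹) (volume.restrict (Ioo 0 ε)) := by
    refine (hk'.const_mul (2 / |L|)).mono (measurable_inv.aestronglyMeasurable) ?_
    filter_upwards [hle', ae_restrict_mem measurableSet_Ioo] with x hx hx0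
    have hxδ : |L| / 2 < |F x| := hδ ⟨hx0.1, hx0.2.trans_le (min_le_left _ _)⟩
    have hx1 : |L| / 2 ≤ x * k x := hxδ.le.trans hx
    have hkx : 0 ≤ k x := by
      by_contra hneg
      have := mul_neg_of_pos_of_neg hx0.1 (not_le.1 hneg)
      linarith
    rw [Real.norm_eq_abs, Real.norm_eq_abs, abs_of_pos (inv_pos.2 hx0.1),
      abs_of_nonneg (by positivity), inv_le_iff_one_le_mul₀ hx0.1]
    calc (1 : ℝ) = 2 / |L| * (|L| / 2) := by field_simp
      _ ≤ 2 / |L| * (x * k x) := by gcongr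
      _ = 2 / |L| * k x * x := by ring
  have := (intervalIntegrable_iff_integrableOn_Ioo_of_le hε0.le).2 hinv
  rw [intervalIntegrable_inv_iff] at this
  rcases this with h | h
  · exact hε0.ne h
  · exact h left_mem_uIcc

/-- Fundamental theorem of calculus on `(0,1)` with no boundary contribution at `0`. -/
lemma LocAC.integral_eq {F G k : ℝ → ℝ} (hF : LocAC F) (hG : ∀ᵐ x ∂unitMeas, D F x = G x)
    (hGi : Integrable G unitMeas) (hk : Integrable k unitMeas)
    (hle : ∀ᵐ x ∂unitMeas, |F x| ≤ x * k x) : ∫ x, G x ∂unitMeas = F 1 := by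
  have := limit_eq_zero_of_le (hF.tendsto hG hGi) hk hle
  linarith

/-! ### Square-integrable functions -/

lemma MemL2.integrable_mul {f g : ℝ → ℝ} (hf : MemL2 f) (hg : MemL2 g) :
    Integrable (fun x => f x * g x) unitMeas := MemLp.integrable_mul hf hg

lemma MemL2.integrable_sq' {f : ℝ → ℝ} (hf : MemL2 f) :
    Integrable (fun x => f x ^ 2) unitMeas := MemLp.integrable_sq hf

lemma memL2_of_le {f g : ℝ → ℝ} (hf : AEStronglyMeasurable f unitMeas) (hg : MemL2 g) (C : ℝ)
    (h : ∀ᵐ x ∂unitMeas, |f x| ≤ C * |g x|) : MemL2 f :=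
  MemLp.of_le_mul (c := C) hg hf h

lemma memL2_of_bounded {f : ℝ → ℝ} (hf : AEStronglyMeasurable f unitMeas) (C : ℝ)
    (h : ∀ᵐ x ∂unitMeas, |f x| ≤ C) : MemL2 f := MemLp.of_bound hf C h

lemma integral_comb₂ {f g : ℝ → ℝ} (hf : Integrable f unitMeas) (hg : Integrable g unitMeas)
    (a b : ℝ) : ∫ x, (a * f x + b * g x) ∂unitMeas =
      a * (∫ x, f x ∂unitMeas) + b * ∫ x, g x ∂unitMeas := by
  rw [integral_add (hf.const_mul a) (hg.const_mul b), integral_const_mul, integral_const_mul]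

lemma integral_comb₃ {f g h : ℝ → ℝ} (hf : Integrable f unitMeas) (hg : Integrable g unitMeas)
    (hh : Integrable h unitMeas) (a b c : ℝ) :
    ∫ x, (a * f x + b * g x + c * h x) ∂unitMeas =
      a * (∫ x, f x ∂unitMeas) + b * (∫ x, g x ∂unitMeas) + c * ∫ x, h x ∂unitMeas := by
  have h1 : Integrable (fun x => a * f x + b * g x) unitMeas :=
    (hf.const_mul a).add (hg.const_mul b)
  rw [integral_add h1 (hh.const_mul c), integral_comb₂ hf hg, integral_const_mul]

/-- Cauchy–Schwarz, from the discriminant of the nonnegative quadratic $t\mapsto\int(tg-f)^2$. -/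
lemma integral_mul_sq_le {f g : ℝ → ℝ} (hf : MemL2 f) (hg : MemL2 g) :
    (∫ x, f x * g x ∂unitMeas) ^ 2 ≤ (∫ x, f x ^ 2 ∂unitMeas) * ∫ x, g x ^ 2 ∂unitMeas := by
  have h : ∀ t : ℝ, 0 ≤ (∫ x, g x ^ 2 ∂unitMeas) * (t * t)
      + (-2 * ∫ x, f x * g x ∂unitMeas) * t + ∫ x, f x ^ 2 ∂unitMeas := fun t => by
    have h0 : 0 ≤ ∫ x, (t * g x - f x) ^ 2 ∂unitMeas := integral_nonneg fun x => sq_nonneg _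
    have e : (fun x => (t * g x - f x) ^ 2) =
        fun x => t * t * g x ^ 2 + (-2 * t) * (f x * g x) + 1 * f x ^ 2 := by
      funext x; ring
    rw [e, integral_comb₃ hg.integrable_sq' (hf.integrable_mul hg) hf.integrable_sq'] at h0
    linarith
  have := discrim_le_zero h
  unfold discrim at this
  nlinarith

/-! ### Pointwise bounds on the coefficient. -/

namespace Admissible

variable {a : ℝ → ℝ}

lemma mu_nonneg (ha : Admissible a) : 0 ≤ muA a := by
  have h1 : (1 : ℝ) ∈ Ioc (0 : ℝ) 1 := ⟨one_pos, le_rfl⟩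
  refine le_trans ?_ (le_csSup ha.bddAbove ⟨1, h1, rfl⟩)
  have := ha.pos 1 h1
  positivity

lemma one_pos' (ha : Admissible a) : 0 < a 1 := ha.pos 1 ⟨one_pos, le_rfl⟩

lemma mul_abs_D_le (ha : Admissible a) {x : ℝ} (hx : x ∈ Ioc (0 : ℝ) 1) :
    x * |D a x| ≤ muA a * a x := by
  have := le_csSup ha.bddAbove ⟨x, hx, rfl⟩
  rwa [div_le_iff₀ (ha.pos x hx)] at this

lemma hasDerivAt (ha : Admissible a) {x : ℝ} (hx : x ∈ Ioo (0 : ℝ) 1) :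
    HasDerivAt a (D a x) x := by
  have h := (ha.contDiffOn.differentiableOn one_ne_zero) x (Ioo_subset_Ioc_self hx)
  exact h.hasDerivWithinAt.hasDerivAt (Ioc_mem_nhds hx)

/-- Since $ya'\le\mu_a a$, the function $a(y)y^{-\mu_a}$ is nonincreasing; compare its values at $x$
and $1$. -/
lemma mul_rpow_le (ha : Admissible a) {x : ℝ} (hx : x ∈ Ioc (0 : ℝ) 1) :
    a 1 * x ^ muA a ≤ a x := by
  have hder : ∀ y ∈ Ioo (0 : ℝ) 1, HasDerivAt (fun y => a y * y ^ (-muA a))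
      (D a y * y ^ (-muA a) + a y * (-muA a * y ^ (-muA a - 1))) y := fun y hy =>
    (ha.hasDerivAt hy).mul (Real.hasDerivAt_rpow_const (Or.inl hy.1.ne'))
  have hanti : AntitoneOn (fun y => a y * y ^ (-muA a)) (Ioc 0 1) := by
    refine antitoneOn_of_deriv_nonpos (convex_Ioc 0 1) ?_ ?_ ?_
    · exact ha.contDiffOn.continuousOn.mul
        (continuousOn_id.rpow_const fun y hy => Or.inl hy.1.ne')
    · rw [interior_Ioc]
      exact fun y hy => (hder y hy).differentiableAt.differentiableWithinAt
    · rw [interior_Ioc]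
      intro y hy
      rw [(hder y hy).deriv, Real.rpow_sub_one hy.1.ne']
      have h1 := ha.mul_abs_D_le (Ioo_subset_Ioc_self hy)
      have h2 : y * D a y ≤ muA a * a y :=
        (mul_le_mul_of_nonneg_left (le_abs_self _) hy.1.le).trans h1
      have h3 : 0 < y ^ (-muA a) := Real.rpow_pos_of_pos hy.1 _
      have e : D a y * y ^ (-muA a) + a y * (-muA a * (y ^ (-muA a) / y)) =
          y ^ (-muA a) / y * (y * D a y - muA a * a y) := by
        have := hy.1.ne'
        field_simp
        ring
      rw [e]
      exact mul_nonpos_of_nonneg_of_nonpos (div_nonneg h3.le hy.1.le) (by linarith)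
  have := hanti hx ⟨one_pos, le_rfl⟩ hx.2
  simp only [Real.one_rpow, mul_one] at this
  rwa [Real.rpow_neg hx.1.le, ← div_eq_mul_inv, le_div_iff₀ (Real.rpow_pos_of_pos hx.1 _)] at this

lemma mul_sq_le (ha : Admissible a) {x : ℝ} (hx : x ∈ Ioc (0 : ℝ) 1) :
    a 1 * x ^ 2 ≤ a x := by
  refine le_trans ?_ (ha.mul_rpow_le hx)
  have h : x ^ (2 : ℝ) ≤ x ^ muA a := Real.rpow_le_rpow_of_exponent_ge hx.1 hx.2 ha.mu_lt_two.le
  rw [Real.rpow_two] at h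
  exact mul_le_mul_of_nonneg_left h ha.one_pos'.le

/-- Here $[\mu_a]=1$, so $a\in C^1([0,1])$ is Lipschitz, and $a(0)=0$. This linear bound is what
makes the flux vanish at $0$ in the strongly degenerate case. -/
lemma exists_le_mul (ha : Admissible a) (hμ : 1 ≤ muA a) :
    ∃ C : ℝ, ∀ x ∈ Ioc (0 : ℝ) 1, a x ≤ C * x := by
  have hfl : ⌊muA a⌋₊ = 1 := by
    rw [Nat.floor_eq_iff (by linarith)]
    exact ⟨by simpa using hμ, by have := ha.mu_lt_two; norm_num; linarith⟩
  have h := ha.contDiffOn_floor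
  rw [hfl] at h
  obtain ⟨K, hK⟩ := h.exists_lipschitzOnWith (by norm_num) (convex_Icc _ _) isCompact_Icc
  refine ⟨K, fun x hx => ?_⟩
  have := hK.dist_le_mul x ⟨hx.1.le, hx.2⟩ 0 ⟨le_rfl, zero_le_one⟩
  rw [ha.zero, Real.dist_eq, Real.dist_eq, sub_zero, sub_zero, abs_of_pos hx.1] at this
  exact (le_abs_self _).trans this

lemma locAC (ha : Admissible a) : LocAC a := LocAC.of_contDiffOn ha.contDiffOn

lemma locAC_inv (ha : Admissible a) : LocAC (fun x => (a x)⁻¹) :=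
  LocAC.of_contDiffOn (ha.contDiffOn.inv fun x hx => (ha.pos x hx).ne')

lemma aestronglyMeasurable (ha : Admissible a) : AEStronglyMeasurable a unitMeas :=
  ha.locAC.aestronglyMeasurable

end Admissible

lemma MemV1.locAC {a f : ℝ → ℝ} (hf : MemV1 a f) : LocAC f := hf.locallyAC

lemma locAC_id : LocAC (fun x => x) := LocAC.of_contDiffOn contDiffOn_id

lemma D_id {x : ℝ} (hx : x ∈ Ioo (0 : ℝ) 1) : D (fun y => y) x = 1 := by
  rw [D_eq_deriv _ hx]
  simp

/-! ### Hardy and Poincaré inequalities with explicit constants. -/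

section Poincare

variable {a f : ℝ → ℝ}

lemma MemV1.memL2_mul_D (ha : Admissible a) (hf : MemV1 a f) : MemL2 (fun x => x * D f x) := by
  refine memL2_of_le (measurable_id.aestronglyMeasurable.mul (LocAC.aestronglyMeasurable_D f))
    hf.deriv_memL2 (√(a 1))⁻¹ ?_
  filter_upwards [ae_unitMeas_mem] with x hx
  have h1 := Real.sqrt_pos.2 ha.one_pos'
  have h : √(a 1) * x ≤ √(a x) := by
    have := Real.sqrt_le_sqrt (ha.mul_sq_le (Ioo_subset_Ioc_self hx))
    rwa [Real.sqrt_mul ha.one_pos'.le, Real.sqrt_sq hx.1.le] at this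
  rw [abs_mul, abs_mul, abs_of_pos hx.1, abs_of_nonneg (Real.sqrt_nonneg _), ← mul_assoc]
  refine mul_le_mul_of_nonneg_right ?_ (abs_nonneg _)
  rwa [← div_eq_inv_mul, le_div_iff₀ h1, mul_comm]

lemma ae_sqrt_mul_sq (ha : Admissible a) (g : ℝ → ℝ) :
    ∀ᵐ x ∂unitMeas, (√(a x) * g x) ^ 2 = a x * g x ^ 2 := by
  filter_upwards [ae_unitMeas_mem] with x hx
  rw [mul_pow, Real.sq_sqrt (ha.pos x (Ioo_subset_Ioc_self hx)).le]

lemma MemV1.integrable_energy (ha : Admissible a) (hf : MemV1 a f) :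
    Integrable (fun x => a x * D f x ^ 2) unitMeas :=
  hf.deriv_memL2.integrable_sq'.congr (ae_sqrt_mul_sq ha (D f))

lemma integral_energy_nonneg (ha : Admissible a) (f : ℝ → ℝ) :
    0 ≤ ∫ x, a x * D f x ^ 2 ∂unitMeas := by
  refine integral_nonneg_of_ae ?_
  filter_upwards [ae_unitMeas_mem] with x hx
  have := ha.pos x (Ioo_subset_Ioc_self hx)
  positivity

lemma MemV1.integral_mul_D_sq_le (ha : Admissible a) (hf : MemV1 a f) :
    ∫ x, (x * D f x) ^ 2 ∂unitMeas ≤ 1 / a 1 * ∫ x, a x * D f x ^ 2 ∂unitMeas := by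
  rw [← integral_const_mul]
  refine integral_mono_ae (hf.memL2_mul_D ha).integrable_sq'
    ((hf.integrable_energy ha).const_mul _) ?_
  filter_upwards [ae_unitMeas_mem] with x hx
  have h := ha.mul_sq_le (Ioo_subset_Ioc_self hx)
  have h1 := ha.one_pos'
  rw [div_mul_eq_mul_div, one_mul, le_div_iff₀ h1]
  nlinarith [sq_nonneg (D f x)]

/-- Integrating $(xf^2)'$ gives $\int f^2+2\int f\,xf'=f(1)^2$. Young's inequality absorbs half of
$\int f^2$, and $a(1)x^2\le a$ controls $\int(xf')^2$. This provides the entry $4$ of the minimum in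
$C_a'$. -/
lemma MemV1.integral_sq_le_hardy (ha : Admissible a) (hf : MemV1 a f) :
    ∫ x, f x ^ 2 ∂unitMeas ≤ 2 * f 1 ^ 2 + 4 / a 1 * ∫ x, a x * D f x ^ 2 ∂unitMeas := by
  have hm := hf.memL2_mul_D ha
  have h1 := hf.memL2.integrable_sq'
  have h2 := hf.memL2.integrable_mul hm
  have hF : LocAC (fun x => x * (f x * f x)) := locAC_id.mul (hf.locAC.mul hf.locAC)
  have e := hF.integral_eq (G := fun x => 1 * f x ^ 2 + 2 * (f x * (x * D f x)))
    (k := fun x => f x ^ 2) (by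
      filter_upwards [locAC_id.ae_D_mul (hf.locAC.mul hf.locAC), hf.locAC.ae_D_mul hf.locAC,
        ae_unitMeas_mem] with x e1 e2 hx
      rw [e1, e2, D_id hx]
      ring) ((h1.const_mul 1).add (h2.const_mul 2)) h1 (by
      filter_upwards [ae_unitMeas_mem] with x hx
      rw [abs_mul, abs_of_pos hx.1, abs_mul_self, sq])
  rw [integral_comb₂ h1 h2] at e
  have h3 : 0 ≤ ∫ x, (1 / 2 * f x ^ 2 + 2 * (f x * (x * D f x)) + 2 * (x * D f x) ^ 2) ∂unitMeas :=
    integral_nonneg fun x => by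
      have : 1 / 2 * f x ^ 2 + 2 * (f x * (x * D f x)) + 2 * (x * D f x) ^ 2 =
        1 / 2 * (f x + 2 * (x * D f x)) ^ 2 := by ring
      simp only [Pi.zero_apply]
      rw [this]
      positivity
  rw [integral_comb₃ h1 h2 hm.integrable_sq'] at h3
  have h4 := hf.integral_mul_D_sq_le ha
  have h5 : 4 / a 1 * ∫ x, a x * D f x ^ 2 ∂unitMeas =
    4 * (1 / a 1 * ∫ x, a x * D f x ^ 2 ∂unitMeas) := by ring
  rw [h5]
  nlinarith

/-- Integrate $(mf^2)'$ with $m=x/\varphi$, where $\varphi$ is chosen so that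
$m'-m^2x^{-\mu}=1/\varphi$. Completing the square leaves $(mf^2)'\ge f^2/\varphi-x^{\mu}(f')^2$.
Then $1/\varphi\ge(2-\mu)/2$, $m(1)=2-\mu$ and $a(1)x^\mu\le a$ give the entry $2/(2-\mu_a)$ of the
minimum in $C_a'$. -/
lemma MemV1.integral_sq_le_power (ha : Admissible a) (hf : MemV1 a f) :
    ∫ x, f x ^ 2 ∂unitMeas ≤ 2 * f 1 ^ 2 +
      2 / (2 - muA a) / a 1 * ∫ x, a x * D f x ^ 2 ∂unitMeas := by
  set μ := muA a with hμ
  have hμ2 : 0 < 2 - μ := by have := ha.mu_lt_two; linarith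
  have ha1 := ha.one_pos'
  set φ : ℝ → ℝ := fun x => (2 - x ^ (2 - μ)) / (2 - μ) with hφ
  have hpow : ∀ x ∈ Ioc (0 : ℝ) 1, 0 < x ^ (2 - μ) ∧ x ^ (2 - μ) ≤ 1 := fun x hx =>
    ⟨Real.rpow_pos_of_pos hx.1 _, Real.rpow_le_one hx.1.le hx.2 hμ2.le⟩
  have hφlow : ∀ x ∈ Ioc (0 : ℝ) 1, 1 ≤ (2 - μ) * φ x := fun x hx => by
    have := hpow x hx
    simp only [hφ]
    rw [mul_div_cancel₀ _ hμ2.ne']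
    linarith
  have hφpos : ∀ x ∈ Ioc (0 : ℝ) 1, 0 < φ x := fun x hx =>
    pos_of_mul_pos_right (one_pos.trans_le (hφlow x hx)) hμ2.le
  have hφup : ∀ x ∈ Ioc (0 : ℝ) 1, (2 - μ) * φ x ≤ 2 := fun x hx => by
    have := hpow x hx
    simp only [hφ]
    rw [mul_div_cancel₀ _ hμ2.ne']
    linarith
  have hφd : ∀ x ∈ Ioo (0 : ℝ) 1, HasDerivAt φ (-(x ^ (1 - μ))) x := fun x hx => by
    have h := ((Real.hasDerivAt_rpow_const (p := 2 - μ) (Or.inl hx.1.ne')).const_sub 2).div_const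
      (2 - μ)
    rw [show -((2 - μ) * x ^ (2 - μ - 1)) / (2 - μ) = -(x ^ (1 - μ)) by
      rw [show 2 - μ - 1 = 1 - μ by ring]
      field_simp] at h
    exact h
  have hφc : ContDiffOn ℝ 1 φ (Ioc 0 1) :=
    (contDiffOn_const.sub (contDiffOn_id.rpow_const_of_ne fun x hx => hx.1.ne')).div_const _
  set m : ℝ → ℝ := fun x => x * (φ x)⁻¹ with hm
  have hmc : LocAC m := LocAC.of_contDiffOn
    (contDiffOn_id.mul (hφc.inv fun x hx => (hφpos x hx).ne'))
  have hmd : ∀ x ∈ Ioo (0 : ℝ) 1, D m x = (φ x)⁻¹ + x ^ (2 - μ) * (φ x)⁻¹ ^ 2 := fun x hx => by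
    have hp := (hφpos x (Ioo_subset_Ioc_self hx)).ne'
    have h : HasDerivAt m _ x := (hasDerivAt_id' x).fun_mul ((hφd x hx).fun_inv hp)
    rw [D_eq_deriv _ hx, h.deriv]
    have e : x ^ (2 - μ) = x * x ^ (1 - μ) := by
      rw [show 2 - μ = 1 + (1 - μ) by ring, Real.rpow_add hx.1, Real.rpow_one]
    rw [e]
    field_simp
  have hxf := hf.memL2_mul_D ha
  have hs := hf.memL2.integrable_sq'
  have hc := hf.memL2.integrable_mul hxf
  have hen := hf.integrable_energy ha
  have hinv : ∀ x ∈ Ioc (0 : ℝ) 1, 0 < (φ x)⁻¹ ∧ (φ x)⁻¹ ≤ 2 - μ := fun x hx => by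
    refine ⟨inv_pos.2 (hφpos x hx), ?_⟩
    rw [inv_le_iff_one_le_mul₀ (hφpos x hx)]
    exact hφlow x hx
  have hφm : AEStronglyMeasurable (fun x => (φ x)⁻¹) unitMeas :=
    (LocAC.of_contDiffOn (hφc.inv fun x hx => (hφpos x hx).ne')).aestronglyMeasurable
  have hpm : AEStronglyMeasurable (fun x : ℝ => x ^ (2 - μ)) unitMeas :=
    (measurable_id.pow_const _).aestronglyMeasurable
  have hi1 : Integrable (fun x => ((φ x)⁻¹ + x ^ (2 - μ) * (φ x)⁻¹ ^ 2) * f x ^ 2) unitMeas := by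
    refine hs.bdd_mul (c := (2 - μ) + 1 * (2 - μ) ^ 2)
      (hφm.add (hpm.mul (hφm.pow 2))) ?_
    filter_upwards [ae_unitMeas_mem] with x hx
    have hx' := Ioo_subset_Ioc_self hx
    obtain ⟨h0, h1⟩ := hinv x hx'
    obtain ⟨h2, h3⟩ := hpow x hx'
    rw [Real.norm_eq_abs, abs_of_nonneg
      (add_nonneg h0.le (mul_nonneg h2.le (sq_nonneg _)))]
    exact add_le_add h1 (mul_le_mul h3 (pow_le_pow_left₀ h0.le h1 2) (sq_nonneg _) zero_le_one)
  have hi2 : Integrable (fun x => (2 * (φ x)⁻¹) * (f x * (x * D f x))) unitMeas := by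
    refine hc.bdd_mul (c := 2 * (2 - μ)) (hφm.const_mul 2) ?_
    filter_upwards [ae_unitMeas_mem] with x hx
    have h1 := hinv x (Ioo_subset_Ioc_self hx)
    rw [Real.norm_eq_abs, abs_of_nonneg (mul_nonneg zero_le_two h1.1.le)]
    linarith
  have hF : LocAC (fun x => m x * (f x * f x)) := hmc.mul (hf.locAC.mul hf.locAC)
  have e := hF.integral_eq (G := fun x => ((φ x)⁻¹ + x ^ (2 - μ) * (φ x)⁻¹ ^ 2) * f x ^ 2 +
      (2 * (φ x)⁻¹) * (f x * (x * D f x)))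
    (k := fun x => (2 - μ) * f x ^ 2) (by
      filter_upwards [hmc.ae_D_mul (hf.locAC.mul hf.locAC), hf.locAC.ae_D_mul hf.locAC,
        ae_unitMeas_mem] with x e1 e2 hx
      rw [e1, e2, hmd x hx]
      simp only [hm]
      ring) (hi1.add hi2) (hs.const_mul _) (by
      filter_upwards [ae_unitMeas_mem] with x hx
      have h1 := hinv x (Ioo_subset_Ioc_self hx)
      simp only [hm]
      have hn : 0 ≤ x * (φ x)⁻¹ * (f x * f x) :=
        mul_nonneg (mul_nonneg hx.1.le h1.1.le) (mul_self_nonneg _)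
      rw [abs_of_nonneg hn, mul_assoc, ← sq]
      gcongr
      · exact hx.1.le
      · exact h1.2)
  have hm1 : m 1 = 2 - μ := by
    simp only [hm, hφ, Real.one_rpow, one_mul]
    rw [inv_div]
    norm_num
  rw [hm1] at e
  have hmono : ∫ x, ((2 - μ) / 2 * f x ^ 2 + (-(1 / a 1)) * (a x * D f x ^ 2)) ∂unitMeas ≤
      (2 - μ) * (f 1 * f 1) := by
    rw [← e]
    refine integral_mono_ae ((hs.const_mul _).add (hen.const_mul _)) (hi1.add hi2) ?_
    filter_upwards [ae_unitMeas_mem] with x hx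
    have hx' := Ioo_subset_Ioc_self hx
    have h1 := hinv x hx'
    have h2 := ha.mul_rpow_le hx'
    have hlow : (2 - μ) / 2 ≤ (φ x)⁻¹ := by
      rw [← one_div, le_div_iff₀ (hφpos x hx')]
      linarith [hφup x hx']
    have hxmu : x ^ μ ≤ a x / a 1 := by
      rw [le_div_iff₀ ha1]
      linarith
    have hpmu : x ^ (2 - μ) * x ^ μ = x ^ 2 := by
      rw [← Real.rpow_add hx.1, show 2 - μ + μ = (2 : ℝ) by ring, Real.rpow_two]
    have hp1 := (hpow x hx').1
    have hp2 : 0 < x ^ μ := Real.rpow_pos_of_pos hx.1 _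
    -- Multiplied by $x^{2-\mu}$, this expression is a perfect square, because $x^{2-\mu}x^\mu=x^2$.
    have hsq : 0 ≤ x ^ (2 - μ) * (φ x)⁻¹ ^ 2 * f x ^ 2 + 2 * (φ x)⁻¹ * (f x * (x * D f x))
        + x ^ μ * D f x ^ 2 := by
      have e3 : x ^ (2 - μ) * (x ^ (2 - μ) * (φ x)⁻¹ ^ 2 * f x ^ 2
          + 2 * (φ x)⁻¹ * (f x * (x * D f x)) + x ^ μ * D f x ^ 2) =
          (x ^ (2 - μ) * (φ x)⁻¹ * f x + x * D f x) ^ 2 := by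
        linear_combination (D f x ^ 2) * hpmu
      exact nonneg_of_mul_nonneg_right (e3 ▸ sq_nonneg _) hp1
    have hb : x ^ μ * D f x ^ 2 ≤ 1 / a 1 * (a x * D f x ^ 2) := by
      calc x ^ μ * D f x ^ 2 ≤ a x / a 1 * D f x ^ 2 :=
            mul_le_mul_of_nonneg_right hxmu (sq_nonneg _)
        _ = _ := by ring
    have hc := mul_le_mul_of_nonneg_right hlow (sq_nonneg (f x))
    linarith
  rw [integral_comb₂ hs hen] at hmono
  have h6 : (2 - μ) / 2 * ∫ x, f x ^ 2 ∂unitMeas ≤ (2 - μ) * (f 1 * f 1) +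
      1 / a 1 * ∫ x, a x * D f x ^ 2 ∂unitMeas := by linarith
  have h7 := mul_le_mul_of_nonneg_left h6 (div_nonneg zero_le_two hμ2.le : 0 ≤ 2 / (2 - μ))
  calc ∫ x, f x ^ 2 ∂unitMeas = 2 / (2 - μ) * ((2 - μ) / 2 * ∫ x, f x ^ 2 ∂unitMeas) := by
        field_simp
    _ ≤ _ := h7
    _ = _ := by field_simp

lemma constC'_pos (ha : Admissible a) : 0 < constC' a := by
  have h1 := ha.one_pos'
  have h2 : 0 < 2 - muA a := by linarith [ha.mu_lt_two]
  unfold constC'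
  positivity

/-- The Poincaré inequality with the constant `C'_a`. -/
lemma MemV1.integral_sq_le (ha : Admissible a) (hf : MemV1 a f) :
    ∫ x, f x ^ 2 ∂unitMeas ≤ 2 * f 1 ^ 2 + constC' a * ∫ x, a x * D f x ^ 2 ∂unitMeas := by
  unfold constC'
  rcases min_choice 4 (2 / (2 - muA a)) with h | h
  · rw [h, div_mul_eq_mul_div, one_mul]
    exact hf.integral_sq_le_hardy ha
  · rw [h, div_mul_eq_mul_div, one_mul]
    exact hf.integral_sq_le_power ha

lemma constAlpha_pos (ha : Admissible a) {β : ℝ} (hβ : 0 < β) : 0 < constAlpha a β := by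
  have h1 := ha.one_pos'
  have h2 := constC'_pos ha
  unfold constAlpha
  positivity

/-- The two entries of the minimum in $\alpha_a$ say exactly that $\alpha_aC_a'\le1$ and
$2\alpha_a\le\beta a(1)$. -/
lemma MemV1.alpha_mul_integral_sq_le (ha : Admissible a) {β : ℝ} (hβ : 0 < β) (hf : MemV1 a f) :
    constAlpha a β * ∫ x, f x ^ 2 ∂unitMeas ≤
      (∫ x, a x * D f x ^ 2 ∂unitMeas) + β * a 1 * f 1 ^ 2 := by
  have h := hf.integral_sq_le ha
  have hα := constAlpha_pos ha hβ
  have h1 : constAlpha a β * constC' a ≤ 1 := by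
    rw [← le_div_iff₀ (constC'_pos ha)]
    exact min_le_left _ _
  have h2 : constAlpha a β * 2 ≤ β * a 1 := by
    have : constAlpha a β ≤ β * a 1 / 2 := min_le_right _ _
    linarith
  have h3 := mul_le_mul_of_nonneg_left h hα.le
  have h4 := mul_le_mul_of_nonneg_right h1 (integral_energy_nonneg ha f)
  have h5 := mul_le_mul_of_nonneg_right h2 (sq_nonneg (f 1))
  linarith

end Poincare

/-! ### Flux regularity, Green's formula and multiplier identities. -/

section

variable {a u v : ℝ → ℝ}

/-- The divergence-form operator `(a u')'`. -/
def divForm (a u : ℝ → ℝ) : ℝ → ℝ := D (fun x => a x * D u x)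

lemma D_eq_of_hasDerivWithinAt {f g : ℝ → ℝ}
    (h : ∀ x ∈ Ioc (0 : ℝ) 1, HasDerivWithinAt f (g x) (Ioc 0 1) x) {x : ℝ}
    (hx : x ∈ Ioc (0 : ℝ) 1) : D f x = g x :=
  (h x hx).derivWithin (uniqueDiffWithinAt_Ioc_unit hx)

/-- A locally absolutely continuous function whose derivative agrees almost everywhere with a
continuous function is continuously differentiable. -/
lemma LocAC.hasDerivWithinAt_of_ae_eq {f q : ℝ → ℝ} (hf : LocAC f)
    (hq : ContinuousOn q (Ioc 0 1)) (h : ∀ᵐ x ∂unitMeas, D f x = q x) {x : ℝ}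
    (hx : x ∈ Ioc (0 : ℝ) 1) : HasDerivWithinAt f (q x) (Ioc 0 1) x := by
  have hc : x / 2 ∈ Ioo (0 : ℝ) 1 := ⟨by linarith [hx.1], by linarith [hx.1, hx.2]⟩
  set c := x / 2 with hcdef
  have hsub : Icc c 1 ⊆ Ioc 0 1 := fun y hy => ⟨hc.1.trans_le hy.1, hy.2⟩
  -- Extending $q$ by constants beyond $[c,1]$ makes the primitive differentiable on both sides of
  -- $x$, even when $x=1$.
  set Q : ℝ → ℝ := IccExtend hc.2.le ((Icc c 1).domRestrict q) with hQ
  have hQc : Continuous Q := (continuousOn_iff_continuous_domRestrict.1 (hq.mono hsub)).Icc_extend'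
  have hQe : ∀ y ∈ Icc c 1, Q y = q y := fun y hy => IccExtend_of_mem hc.2.le _ hy
  have hrep : ∀ y ∈ Ioc c 1, f y = f 1 - ∫ t in y..1, Q t := fun y hy => by
    have hy' : y ∈ Ioc (0 : ℝ) 1 := hsub ⟨hy.1.le, hy.2⟩
    rcases eq_or_lt_of_le hy.2 with rfl | hlt
    · simp
    · rw [intervalIntegral.integral_congr (g := q), hf.integral_eq_sub h ⟨hy'.1, hlt⟩]
      · ring
      · intro t ht
        rw [uIcc_of_le hy.2] at ht
        exact hQe t ⟨hy.1.le.trans ht.1, ht.2⟩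
  have hd : HasDerivAt (fun y => f 1 - ∫ t in y..1, Q t) (q x) x := by
    have h1 := (intervalIntegral.integral_hasDerivAt_left (hQc.intervalIntegrable x 1)
      (hQc.stronglyMeasurableAtFilter _ _) hQc.continuousAt).const_sub (f 1)
    rw [neg_neg, hQe x ⟨by linarith [hx.1], hx.2⟩] at h1
    exact h1
  have hxc : x ∈ Ioc c 1 := ⟨by linarith [hx.1], hx.2⟩
  refine (hd.hasDerivWithinAt (s := Ioc 0 1)).congr_of_eventuallyEq ?_ (hrep x hxc)
  filter_upwards [self_mem_nhdsWithin, mem_nhdsWithin_of_mem_nhds (Ioi_mem_nhds hxc.1)]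
    with y hy hy'
  exact hrep y ⟨hy', hy.2⟩

/-- Regularity of elements of `V²_a`: the flux `a u'` is absolutely continuous on `[0,1]` and `u`
is continuously differentiable on `(0,1]`. -/
lemma MemV2.exists_flux (ha : Admissible a) (hu : MemV2 a u) :
    ∃ w : ℝ → ℝ, AbsolutelyContinuousOnInterval w 0 1 ∧ MemL2 (D w) ∧
      ∀ x ∈ Ioc (0 : ℝ) 1, HasDerivWithinAt u (w x / a x) (Ioc 0 1) x := by
  obtain ⟨w, hw, hw2, he⟩ := hu.2
  refine ⟨w, hw, hw2, fun x hx => hu.1.locAC.hasDerivWithinAt_of_ae_eq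
    (q := fun x => w x / a x) ?_ ?_ hx⟩
  · exact (LocAC.of_ac hw).continuousOn.div ha.contDiffOn.continuousOn
      fun y hy => (ha.pos y hy).ne'
  · filter_upwards [he, ae_unitMeas_mem] with y hy hy'
    rw [eq_div_iff (ha.pos y (Ioo_subset_Ioc_self hy')).ne', mul_comm]
    exact hy

/-- Pointwise identification of the flux, endpoint $1$ included: it lets $w(1)$ be read as
$a(1)u'(1)$ in boundary terms. -/
lemma flux_eq (ha : Admissible a) {w : ℝ → ℝ}
    (hw : ∀ x ∈ Ioc (0 : ℝ) 1, HasDerivWithinAt u (w x / a x) (Ioc 0 1) x) :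
    EqOn (fun x => a x * D u x) w (Ioc 0 1) := fun x hx => by
  have := (ha.pos x hx).ne'
  simp only [D_eq_of_hasDerivWithinAt hw hx]
  field_simp

lemma MemV2.divForm_memL2 (ha : Admissible a) (hu : MemV2 a u) : MemL2 (divForm a u) := by
  obtain ⟨w, -, hw2, hd⟩ := hu.exists_flux ha
  refine (memLp_congr_ae ?_).1 hw2
  filter_upwards [ae_unitMeas_mem] with x hx
  exact (D_congr (flux_eq ha hd) (Ioo_subset_Ioc_self hx)).symm

lemma tendsto_nhdsGT_of_ac {w : ℝ → ℝ} (hw : AbsolutelyContinuousOnInterval w 0 1) :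
    Tendsto w (𝓝[>] 0) (𝓝 (w 0)) := by
  have h : Tendsto w (𝓝[uIcc 0 1] 0) (𝓝 (w 0)) := hw.continuousOn 0 left_mem_uIcc
  rw [uIcc_of_le zero_le_one] at h
  have h3 := h.mono_left (nhdsWithin_mono 0 Ioo_subset_Icc_self)
  rwa [nhdsWithin_Ioo_eq_nhdsGT zero_lt_one] at h3

/-- Cauchy–Schwarz applied to $\mathbf 1_{(0,x]}$ and $w'$. The factor $x$ is what kills the
boundary term of Green's formula at $0$ when $w(0)=0$. -/
lemma sq_sub_le_of_ac {w : ℝ → ℝ} (hw : AbsolutelyContinuousOnInterval w 0 1)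
    (hw2 : MemL2 (D w)) {x : ℝ} (hx : x ∈ Ioo (0 : ℝ) 1) :
    (w x - w 0) ^ 2 ≤ x * ∫ y, D w y ^ 2 ∂unitMeas := by
  have hsub : Ioc 0 x ⊆ Ioo (0 : ℝ) 1 := fun y hy => ⟨hy.1, hy.2.trans_lt hx.2⟩
  have e1 : w x - w 0 = ∫ y, (Ioc 0 x).indicator 1 y * D w y ∂unitMeas := by
    have hw' : AbsolutelyContinuousOnInterval w 0 x := hw.mono (by
      rw [uIcc_of_le hx.1.le, uIcc_of_le zero_le_one]
      exact Icc_subset_Icc le_rfl hx.2.le)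
    rw [← hw'.integral_deriv_eq_sub, intervalIntegral.integral_of_le hx.1.le]
    have e2 : (fun y => (Ioc 0 x).indicator (1 : ℝ → ℝ) y * D w y) =
        (Ioc 0 x).indicator (D w) := by
      funext y
      by_cases hy : y ∈ Ioc 0 x <;> simp [hy]
    rw [e2, integral_indicator measurableSet_Ioc, Measure.restrict_restrict measurableSet_Ioc,
      inter_eq_left.2 hsub]
    exact setIntegral_congr_fun measurableSet_Ioc fun y hy => (D_eq_deriv w (hsub hy)).symm
  have hone : MemL2 ((Ioc 0 x).indicator (1 : ℝ → ℝ)) := by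
    refine memL2_of_bounded ((stronglyMeasurable_one.indicator
      measurableSet_Ioc).aestronglyMeasurable) 1 (ae_of_all _ fun y => ?_)
    by_cases hy : y ∈ Ioc 0 x <;> simp [hy]
  have e3 : ∫ y, (Ioc 0 x).indicator (1 : ℝ → ℝ) y ^ 2 ∂unitMeas = x := by
    have e2 : (fun y => (Ioc 0 x).indicator (1 : ℝ → ℝ) y ^ 2) = (Ioc 0 x).indicator 1 := by
      funext y
      by_cases hy : y ∈ Ioc 0 x <;> simp [hy]
    rw [e2, integral_indicator_one measurableSet_Ioc, measureReal_restrict_apply measurableSet_Ioc,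
      inter_eq_left.2 hsub]
    simp [hx.1.le]
  rw [e1]
  refine (integral_mul_sq_le hone hw2).trans ?_
  rw [e3]

/-- The flux of an element of `V²_a` vanishes at `0` if `μ_a ≥ 1`. -/
lemma flux_zero (ha : Admissible a) (hμ : 1 ≤ muA a) (hu : MemV1 a u) {w : ℝ → ℝ}
    (hw : AbsolutelyContinuousOnInterval w 0 1)
    (hd : ∀ x ∈ Ioc (0 : ℝ) 1, HasDerivWithinAt u (w x / a x) (Ioc 0 1) x) : w 0 = 0 := by
  obtain ⟨C, hC⟩ := ha.exists_le_mul hμ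
  have hcont := tendsto_nhdsGT_of_ac hw
  -- $w^2=a\cdot a(u')^2\le Cx\cdot a(u')^2$ with $a(u')^2$ integrable, so $w^2$ cannot have a
  -- nonzero limit.
  have h := limit_eq_zero_of_le (hcont.pow 2) ((hu.integrable_energy ha).const_mul C) (by
    filter_upwards [ae_unitMeas_mem] with x hx
    have hx' := Ioo_subset_Ioc_self hx
    have hp := ha.pos x hx'
    have e : w x = a x * D u x := (flux_eq ha hd hx').symm
    rw [abs_of_nonneg (sq_nonneg _), e]
    have := mul_le_mul_of_nonneg_right (hC x hx') (mul_nonneg hp.le (sq_nonneg (D u x)))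
    calc (a x * D u x) ^ 2 = a x * (a x * D u x ^ 2) := by ring
      _ ≤ _ := this
      _ = _ := by ring)
  exact pow_eq_zero_iff two_ne_zero |>.1 h

lemma integrable_flux_mul (ha : Admissible a) (hu : MemV1 a u) (hv : MemV1 a v) :
    Integrable (fun x => a x * D u x * D v x) unitMeas := by
  refine (hu.deriv_memL2.integrable_mul hv.deriv_memL2).congr ?_
  filter_upwards [ae_unitMeas_mem] with x hx
  have := Real.mul_self_sqrt (ha.pos x (Ioo_subset_Ioc_self hx)).le
  linear_combination (D u x * D v x) * this

/-- Green's formula. -/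
lemma green (ha : Admissible a) (hu : MemV2 a u) (hv : MemW1 a v) :
    (∫ x, divForm a u x * v x ∂unitMeas) + ∫ x, a x * D u x * D v x ∂unitMeas =
      a 1 * D u 1 * v 1 := by
  obtain ⟨w, hw, hw2, hd⟩ := hu.exists_flux ha
  have hfl := flux_eq ha hd
  have hF : LocAC (fun x => w x * v x) := (LocAC.of_ac hw).mul hv.1.locAC
  have hi1 := (hu.divForm_memL2 ha).integrable_mul hv.1.memL2
  have hi2 := integrable_flux_mul ha hu.1 hv.1
  have hG : ∀ᵐ x ∂unitMeas, D (fun x => w x * v x) x =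
      divForm a u x * v x + a x * D u x * D v x := by
    filter_upwards [(LocAC.of_ac hw).ae_D_mul hv.1.locAC, ae_unitMeas_mem] with x e1 hx
    have hx' := Ioo_subset_Ioc_self hx
    have e2 : divForm a u x = D w x := D_congr hfl hx'
    have e3 : a x * D u x = w x := hfl hx'
    rw [e1, e2, e3]
  have ht := hF.tendsto hG (hi1.add hi2)
  rw [integral_add hi1 hi2] at ht
  have e1 : a 1 * D u 1 = w 1 := hfl ⟨one_pos, le_rfl⟩
  rw [e1]
  -- The boundary term $wv$ vanishes at $0$ for different reasons. If $\mu_a<1$, $v\to0$ while $w$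
  -- has a limit. If $\mu_a\ge1$, $w(0)=0$ gives $(wv)^2\le x\,\|w'\|^2v^2$ with $v^2$ integrable.
  rcases lt_or_ge (muA a) 1 with hμ | hμ
  · have h0 := (tendsto_nhdsGT_of_ac hw).mul (hv.2 hμ)
    have := tendsto_nhds_unique ht h0
    linarith
  · have hw0 := flux_zero ha hμ hu.1 hw hd
    have h0 := limit_eq_zero_of_le (ht.pow 2)
      (hv.1.memL2.integrable_sq'.const_mul (∫ y, D w y ^ 2 ∂unitMeas)) (by
        filter_upwards [ae_unitMeas_mem] with x hx
        have h := sq_sub_le_of_ac hw hw2 hx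
        rw [hw0, sub_zero] at h
        rw [abs_of_nonneg (sq_nonneg _), mul_pow, ← mul_assoc]
        exact mul_le_mul_of_nonneg_right h (sq_nonneg _))
    have := pow_eq_zero_iff two_ne_zero |>.1 h0
    linarith

/-- Integration of $(xv^2)'$; the boundary term at $0$ drops because $v^2$ is integrable. -/
lemma integral_mul_D_mul_self (ha : Admissible a) (hv : MemV1 a v) :
    ∫ x, x * D v x * v x ∂unitMeas = 1 / 2 * v 1 ^ 2 - 1 / 2 * ∫ x, v x ^ 2 ∂unitMeas := by
  have h1 := hv.memL2.integrable_sq'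
  have h2 := (hv.memL2_mul_D ha).integrable_mul hv.memL2
  have hF : LocAC (fun x => x * (v x * v x)) := locAC_id.mul (hv.locAC.mul hv.locAC)
  have e := hF.integral_eq (G := fun x => 1 * v x ^ 2 + 2 * (x * D v x * v x))
    (k := fun x => v x ^ 2) (by
      filter_upwards [locAC_id.ae_D_mul (hv.locAC.mul hv.locAC), hv.locAC.ae_D_mul hv.locAC,
        ae_unitMeas_mem] with x e1 e2 hx
      rw [e1, e2, D_id hx]
      ring) ((h1.const_mul 1).add (h2.const_mul 2)) h1 (by
      filter_upwards [ae_unitMeas_mem] with x hx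
      rw [abs_mul, abs_of_pos hx.1, abs_mul_self, sq])
  rw [integral_comb₂ h1 h2] at e
  linarith

lemma integrable_mul_D_coeff (ha : Admissible a) (hu : MemV1 a u) :
    Integrable (fun x => x * D a x * D u x ^ 2) unitMeas := by
  refine ((hu.integrable_energy ha).const_mul (muA a)).mono
    ((measurable_id.aestronglyMeasurable.mul (LocAC.aestronglyMeasurable_D a)).mul
      ((LocAC.aestronglyMeasurable_D u).pow 2)) ?_
  filter_upwards [ae_unitMeas_mem] with x hx
  have hx' := Ioo_subset_Ioc_self hx
  have hp := ha.pos x hx'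
  have h := mul_le_mul_of_nonneg_right (ha.mul_abs_D_le hx') (sq_nonneg (D u x))
  rw [Real.norm_eq_abs, Real.norm_eq_abs, abs_mul, abs_mul, abs_of_pos hx.1,
    abs_of_nonneg (sq_nonneg (D u x)), ← mul_assoc]
  exact h.trans (le_abs_self _)

lemma integral_mul_D_coeff_le (ha : Admissible a) (hu : MemV1 a u) :
    ∫ x, x * D a x * D u x ^ 2 ∂unitMeas ≤ muA a * ∫ x, a x * D u x ^ 2 ∂unitMeas := by
  rw [← integral_const_mul]
  refine integral_mono_ae (integrable_mul_D_coeff ha hu) ((hu.integrable_energy ha).const_mul _) ?_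
  filter_upwards [ae_unitMeas_mem] with x hx
  have h := ha.mul_abs_D_le (Ioo_subset_Ioc_self hx)
  have h2 : x * D a x ≤ muA a * a x :=
    (mul_le_mul_of_nonneg_left (le_abs_self _) hx.1.le).trans h
  have h3 := mul_le_mul_of_nonneg_right h2 (sq_nonneg (D u x))
  linarith

/-- The Rellich-type identity for the multiplier `x u'`. -/
lemma integral_mul_D_mul_divForm (ha : Admissible a) (hu : MemV2 a u) :
    ∫ x, x * D u x * divForm a u x ∂unitMeas = 1 / 2 * a 1 * D u 1 ^ 2
      - 1 / 2 * (∫ x, a x * D u x ^ 2 ∂unitMeas)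
      + 1 / 2 * ∫ x, x * D a x * D u x ^ 2 ∂unitMeas := by
  obtain ⟨w, hw, hw2, hd⟩ := hu.exists_flux ha
  have hfl := flux_eq ha hd
  have hwl := LocAC.of_ac hw
  have h1 := hu.1.integrable_energy ha
  have h2 := integrable_mul_D_coeff ha hu.1
  have h3 := (hu.1.memL2_mul_D ha).integrable_mul (hu.divForm_memL2 ha)
  -- This is $xa(u')^2$ on $(0,1]$, written through factors already known to be locally absolutely
  -- continuous.
  have hF : LocAC (fun x => x * ((w x * w x) * (a x)⁻¹)) :=
    locAC_id.mul ((hwl.mul hwl).mul ha.locAC_inv)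
  have e := hF.integral_eq (G := fun x => 1 * (a x * D u x ^ 2) + (-1) * (x * D a x * D u x ^ 2)
      + 2 * (x * D u x * divForm a u x))
    (k := fun x => a x * D u x ^ 2) (by
      filter_upwards [locAC_id.ae_D_mul ((hwl.mul hwl).mul ha.locAC_inv),
        (hwl.mul hwl).ae_D_mul ha.locAC_inv, hwl.ae_D_mul hwl,
        ae_unitMeas_mem] with x e1 e2 e3 hx
      have hx' := Ioo_subset_Ioc_self hx
      have hp := (ha.pos x hx').ne'
      have e4 : divForm a u x = D w x := D_congr hfl hx'
      have e5 : w x = a x * D u x := (hfl hx').symm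
      have e6 : D (fun y => (a y)⁻¹) x = -D a x / a x ^ 2 := by
        rw [D_eq_deriv _ hx]
        exact ((ha.hasDerivAt hx).fun_inv hp).deriv
      rw [e1, e2, e3, e4, e5, e6, D_id hx]
      field_simp
      ring) (((h1.const_mul 1).add (h2.const_mul (-1))).add (h3.const_mul 2)) h1 (by
      filter_upwards [ae_unitMeas_mem] with x hx
      have hx' := Ioo_subset_Ioc_self hx
      have hp := ha.pos x hx'
      have e5 : w x = a x * D u x := (hfl hx').symm
      have hx0 := hx.1
      have e6 : x * ((w x * w x) * (a x)⁻¹) = x * (a x * D u x ^ 2) := by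
        rw [e5]
        field_simp
      rw [e6, abs_of_nonneg (by positivity)])
  rw [integral_comb₃ h1 h2 h3] at e
  have e1 : w 1 = a 1 * D u 1 := (hfl ⟨one_pos, le_rfl⟩).symm
  have hp := ha.one_pos'.ne'
  have e2 : 1 * (w 1 * w 1 * (a 1)⁻¹) = a 1 * D u 1 ^ 2 := by
    rw [e1]
    field_simp
  rw [e2] at e
  linarith

/-! ### The auxiliary elliptic problem -/

lemma memW1_const (hμ : 1 ≤ muA a) (k : ℝ) : MemW1 a (fun _ => k) := by
  have hD : ∀ x, D (fun _ : ℝ => k) x = 0 := fun x => by simp [D]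
  refine ⟨⟨memLp_const k, (LocAC.of_contDiffOn contDiffOn_const), ?_⟩, fun h => absurd h hμ.not_gt⟩
  simp only [hD, mul_zero]
  exact memLp_const 0

lemma integrable_inv_coeff (ha : Admissible a) (hμ : muA a < 1) :
    Integrable (fun x => (a x)⁻¹) unitMeas := by
  have hr : Integrable (fun x : ℝ => x ^ (-muA a)) unitMeas := by
    have := intervalIntegral.intervalIntegrable_rpow' (a := 0) (b := 1) (r := -muA a)
      (by linarith)
    rwa [intervalIntegrable_iff_integrableOn_Ioo_of_le zero_le_one] at this
  refine (hr.const_mul (a 1)⁻¹).mono ha.locAC_inv.aestronglyMeasurable ?_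
  filter_upwards [ae_unitMeas_mem] with x hx
  have hx' := Ioo_subset_Ioc_self hx
  have hp := ha.pos x hx'
  have hp1 := ha.one_pos'
  have hr := Real.rpow_pos_of_pos hx.1 (muA a)
  rw [Real.rpow_neg hx.1.le, ← mul_inv, Real.norm_eq_abs, Real.norm_eq_abs,
    abs_of_pos (by positivity), abs_of_pos (by positivity)]
  exact inv_anti₀ (by positivity) (ha.mul_rpow_le hx')

/-- Solvability of the auxiliary elliptic problem
`∫ a u' ζ' + β a(1) u(1) ζ(1) = u(1)` for all `u ∈ W¹_a`. -/
lemma exists_corrector (ha : Admissible a) {β : ℝ} (hβ : 0 < β) :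
    ∃ ζ : ℝ → ℝ, MemW1 a ζ ∧ ∀ u : ℝ → ℝ, MemW1 a u →
      (∫ x, a x * D u x * D ζ x ∂unitMeas) + β * a 1 * u 1 * ζ 1 = u 1 := by
  have hp1 := ha.one_pos'
  rcases lt_or_ge (muA a) 1 with hμ | hμ
  · have hi := integrable_inv_coeff ha hμ
    have hii : IntervalIntegrable (fun x => (a x)⁻¹) volume 0 1 :=
      (intervalIntegrable_iff_integrableOn_Ioo_of_le zero_le_one).2 hi
    -- Weak degeneracy: $1/a$ is integrable and $\zeta=cR$ has constant flux $c$. As $u(0)=0$, $\int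
    -- au'\zeta'=c\,u(1)$, so the identity amounts to $c(1+\beta a(1)R(1))=1$.
    set R : ℝ → ℝ := fun x => ∫ t in (0 : ℝ)..x, (a t)⁻¹ with hR
    have hR1 : 0 ≤ R 1 := by
      refine intervalIntegral.integral_nonneg_of_ae_restrict zero_le_one ?_
      rw [Measure.restrict_congr_set Ioo_ae_eq_Icc.symm]
      filter_upwards [ae_unitMeas_mem] with x hx
      exact (inv_pos.2 (ha.pos x (Ioo_subset_Ioc_self hx))).le
    set c : ℝ := (1 + β * a 1 * R 1)⁻¹ with hc
    have hden : 0 < 1 + β * a 1 * R 1 := by positivity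
    have hRac : AbsolutelyContinuousOnInterval R 0 1 :=
      hii.absolutelyContinuousOnInterval_intervalIntegral left_mem_uIcc
    have hζac := hRac.const_mul c
    have hRd : ∀ᵐ x ∂unitMeas, D R x = (a x)⁻¹ := by
      rw [ae_restrict_iff' measurableSet_Ioo]
      filter_upwards [hii.ae_hasDerivAt_integral] with x hx hx1
      rw [D_eq_deriv _ hx1]
      refine (hx ?_ 0 left_mem_uIcc).deriv
      rw [uIcc_of_le zero_le_one]
      exact Ioo_subset_Icc_self hx1
    have hζd : ∀ᵐ x ∂unitMeas, D (fun x => c * R x) x = c * (a x)⁻¹ := by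
      filter_upwards [(LocAC.of_ac hRac).ae_D_const_mul c, hRd] with x h1 h2
      rw [h1, h2]
    obtain ⟨B, hB⟩ := hζac.exists_bound
    have hinvsq : MemL2 (fun x => √(a x) * D (fun x => c * R x) x) := by
      have hmeas : AEStronglyMeasurable (fun x => √(a x) * D (fun x => c * R x) x) unitMeas :=
        (Real.continuous_sqrt.comp_aestronglyMeasurable ha.aestronglyMeasurable).mul
          (LocAC.aestronglyMeasurable_D _)
      refine (memLp_two_iff_integrable_sq hmeas).2 ((hi.const_mul (c ^ 2)).congr ?_)
      filter_upwards [hζd, ae_unitMeas_mem] with x h hx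
      have hp := ha.pos x (Ioo_subset_Ioc_self hx)
      rw [h, mul_pow, Real.sq_sqrt hp.le]
      field_simp
    have hζ2 : MemL2 (fun x => c * R x) := by
      refine memL2_of_bounded (LocAC.of_ac hζac).aestronglyMeasurable B ?_
      filter_upwards [ae_unitMeas_mem] with x hx
      refine hB x ?_
      rw [uIcc_of_le zero_le_one]
      exact Ioo_subset_Icc_self hx
    have hζV : MemV1 a (fun x => c * R x) := ⟨hζ2, LocAC.of_ac hζac, hinvsq⟩
    refine ⟨fun x => c * R x, ⟨hζV, fun _ => ?_⟩, fun u hu => ?_⟩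
    · have h3 := tendsto_nhdsGT_of_ac hζac
      simpa [hR] using h3
    · have hae : (fun x => a x * D u x * D (fun x => c * R x) x) =ᵐ[unitMeas]
          fun x => c * D u x := by
        filter_upwards [hζd, ae_unitMeas_mem] with x h hx
        have hp := ha.pos x (Ioo_subset_Ioc_self hx)
        rw [h]
        field_simp
      have hcpos : 0 < c := inv_pos.2 hden
      have hDu : Integrable (D u) unitMeas := by
        have h1 := integrable_flux_mul ha hu.1 hζV
        have h2 := (h1.congr hae).const_mul c⁻¹
        refine h2.congr (ae_of_all _ fun x => ?_)
        simp only
        field_simp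
      have hlim := hu.1.locAC.tendsto (ae_of_all _ fun x => rfl) hDu
      have h0 := tendsto_nhds_unique hlim (hu.2 hμ)
      rw [integral_congr_ae hae, integral_const_mul, show ∫ x, D u x ∂unitMeas = u 1 by linarith]
      have : c * (1 + β * a 1 * R 1) = 1 := inv_mul_cancel₀ hden.ne'
      linear_combination u 1 * this
  -- Strong degeneracy: constants belong to $W^1_a$, and the constant $1/(\beta a(1))$ solves the
  -- problem.
  · refine ⟨fun _ => (β * a 1)⁻¹, memW1_const hμ _, fun u _ => ?_⟩
    have hD : ∀ x, D (fun _ : ℝ => (β * a 1)⁻¹) x = 0 := fun x => by simp [D]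
    simp only [hD, mul_zero, integral_zero, zero_add]
    field_simp

/-- Testing with $u=\zeta$ gives $\int a(\zeta')^2+\beta a(1)\zeta(1)^2=\zeta(1)$. The two bounds on
$\zeta(1)$ follow, and the Poincaré inequality then gives $\alpha_a\int\zeta^2\le\zeta(1)$. -/
lemma corrector_bounds (ha : Admissible a) {β : ℝ} (hβ : 0 < β) {ζ : ℝ → ℝ} (hζ : MemW1 a ζ)
    (h : ∀ u : ℝ → ℝ, MemW1 a u →
      (∫ x, a x * D u x * D ζ x ∂unitMeas) + β * a 1 * u 1 * ζ 1 = u 1) :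
    0 ≤ ζ 1 ∧ β * a 1 * ζ 1 ≤ 1 ∧
      constAlpha a β * (β * a 1) * ∫ x, ζ x ^ 2 ∂unitMeas ≤ 1 := by
  have hp1 := ha.one_pos'
  have hb : 0 < β * a 1 := by positivity
  have h1 := h ζ hζ
  have e : ∫ x, a x * D ζ x * D ζ x ∂unitMeas = ∫ x, a x * D ζ x ^ 2 ∂unitMeas := by
    congr 1
    funext x
    ring
  rw [e] at h1
  have h2 := integral_energy_nonneg ha ζ
  have h3 := hζ.1.alpha_mul_integral_sq_le ha hβ
  have h0 : 0 ≤ ζ 1 := by nlinarith [mul_nonneg hb.le (sq_nonneg (ζ 1))]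
  have h4 : β * a 1 * ζ 1 ≤ 1 := by
    rcases h0.eq_or_lt with h5 | h5
    · rw [← h5]; simp
    · by_contra hcon
      push Not at hcon
      nlinarith
  refine ⟨h0, h4, ?_⟩
  have h6 : constAlpha a β * ∫ x, ζ x ^ 2 ∂unitMeas ≤ ζ 1 := by nlinarith
  calc constAlpha a β * (β * a 1) * ∫ x, ζ x ^ 2 ∂unitMeas
      = β * a 1 * (constAlpha a β * ∫ x, ζ x ^ 2 ∂unitMeas) := by ring
    _ ≤ β * a 1 * ζ 1 := by gcongr
    _ ≤ 1 := h4

end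

section

variable {a : ℝ → ℝ} {β : ℝ}

/-! ### Linear structure of the function spaces -/

lemma MemV1.sub {f g : ℝ → ℝ} (hf : MemV1 a f) (hg : MemV1 a g) : MemV1 a (f - g) where
  memL2 := MemLp.sub hf.memL2 hg.memL2
  locallyAC := hf.locAC.sub hg.locAC
  deriv_memL2 := by
    refine (memLp_congr_ae ?_).1 (MemLp.sub hf.deriv_memL2 hg.deriv_memL2)
    filter_upwards [hf.locAC.ae_D_sub hg.locAC] with x h
    have h' : D (f - g) x = D f x - D g x := h
    rw [h', Pi.sub_apply]
    ring

lemma MemV1.smul {f : ℝ → ℝ} (k : ℝ) (hf : MemV1 a f) : MemV1 a (k • f) where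
  memL2 := MemLp.const_smul hf.memL2 k
  locallyAC := hf.locAC.const_mul k
  deriv_memL2 := by
    refine (memLp_congr_ae ?_).1 (MemLp.const_smul hf.deriv_memL2 k)
    filter_upwards [hf.locAC.ae_D_const_mul k] with x h
    have h' : D (k • f) x = k * D f x := h
    rw [h', Pi.smul_apply, smul_eq_mul]
    ring

lemma MemW1.sub {f g : ℝ → ℝ} (hf : MemW1 a f) (hg : MemW1 a g) : MemW1 a (f - g) :=
  ⟨hf.1.sub hg.1, fun h => by
    have h' := (hf.2 h).sub (hg.2 h)
    rwa [sub_zero] at h'⟩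

lemma MemW1.smul {f : ℝ → ℝ} (k : ℝ) (hf : MemW1 a f) : MemW1 a (k • f) :=
  ⟨hf.1.smul k, fun h => by
    have h' := (hf.2 h).const_smul k
    rwa [smul_zero] at h'⟩

lemma MemV2.sub {f g : ℝ → ℝ} (hf : MemV2 a f) (hg : MemV2 a g) : MemV2 a (f - g) := by
  refine ⟨hf.1.sub hg.1, ?_⟩
  obtain ⟨w, hw, hw2, he⟩ := hf.2
  obtain ⟨z, hz, hz2, hez⟩ := hg.2
  refine ⟨fun x => w x - z x, hw.fun_sub hz, ?_, ?_⟩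
  · refine (memLp_congr_ae ?_).1 (MemLp.sub hw2 hz2)
    filter_upwards [(LocAC.of_ac hw).ae_D_sub (LocAC.of_ac hz)] with x h
    rw [h, Pi.sub_apply]
  · filter_upwards [he, hez, hf.1.locAC.ae_D_sub hg.1.locAC] with x h1 h2 h3
    have h' : D (f - g) x = D f x - D g x := h3
    rw [h', ← h1, ← h2]
    ring

lemma MemV2.smul {f : ℝ → ℝ} (k : ℝ) (hf : MemV2 a f) : MemV2 a (k • f) := by
  refine ⟨hf.1.smul k, ?_⟩
  obtain ⟨w, hw, hw2, he⟩ := hf.2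
  refine ⟨fun x => k * w x, hw.const_mul k, ?_, ?_⟩
  · refine (memLp_congr_ae ?_).1 (MemLp.const_smul hw2 k)
    filter_upwards [(LocAC.of_ac hw).ae_D_const_mul k] with x h
    rw [h, Pi.smul_apply, smul_eq_mul]
  · filter_upwards [he, hf.1.locAC.ae_D_const_mul k] with x h1 h3
    have h' : D (k • f) x = k * D f x := h3
    rw [h', ← h1]
    ring

/-- On $V^2_a$ the derivative is additive at every point of $(0,1]$, not just almost everywhere; at
$x=1$ this makes the boundary condition in $D(A_\beta)$ linear. -/
lemma MemV2.D_sub {f g : ℝ → ℝ} (ha : Admissible a) (hf : MemV2 a f) (hg : MemV2 a g)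
    {x : ℝ} (hx : x ∈ Ioc (0 : ℝ) 1) : D (f - g) x = D f x - D g x := by
  obtain ⟨w, -, -, hw⟩ := hf.exists_flux ha
  obtain ⟨z, -, -, hz⟩ := hg.exists_flux ha
  exact derivWithin_sub (hw x hx).differentiableWithinAt (hz x hx).differentiableWithinAt

lemma MemV2.D_smul {f : ℝ → ℝ} (k : ℝ) (ha : Admissible a) (hf : MemV2 a f)
    {x : ℝ} (hx : x ∈ Ioc (0 : ℝ) 1) : D (k • f) x = k * D f x := by
  obtain ⟨w, -, -, hw⟩ := hf.exists_flux ha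
  exact derivWithin_const_smul k (hw x hx).differentiableWithinAt

lemma MemV2.locAC_flux {f : ℝ → ℝ} (ha : Admissible a) (hf : MemV2 a f) :
    LocAC (fun x => a x * D f x) := by
  obtain ⟨w, hw, -, hd⟩ := hf.exists_flux ha
  intro c hc
  have h := LocAC.of_ac hw c hc
  -- Absolute continuity only tests values at endpoints of subintervals of $[c,1]$, where the flux
  -- and $w$ coincide.
  refine Tendsto.congr' ?_ h
  filter_upwards [mem_inf_of_right (mem_principal_self _)] with E hE
  refine Finset.sum_congr rfl fun i hi => ?_
  have h1 := hE.1 i hi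
  rw [← flux_eq ha hd (LocAC.uIcc_sub hc h1.1), ← flux_eq ha hd (LocAC.uIcc_sub hc h1.2)]

lemma MemV2.ae_divForm_sub {f g : ℝ → ℝ} (ha : Admissible a) (hf : MemV2 a f) (hg : MemV2 a g) :
    ∀ᵐ x ∂unitMeas, divForm a (f - g) x = divForm a f x - divForm a g x := by
  filter_upwards [(hf.locAC_flux ha).ae_D_sub (hg.locAC_flux ha), ae_unitMeas_mem] with x h hx
  unfold divForm
  rw [← h]
  refine D_congr (fun y hy => ?_) (Ioo_subset_Ioc_self hx)
  simp only [hf.D_sub ha hg hy]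
  ring

lemma MemV2.ae_divForm_smul {f : ℝ → ℝ} (k : ℝ) (ha : Admissible a) (hf : MemV2 a f) :
    ∀ᵐ x ∂unitMeas, divForm a (k • f) x = k * divForm a f x := by
  filter_upwards [(hf.locAC_flux ha).ae_D_const_mul k, ae_unitMeas_mem] with x h hx
  unfold divForm
  rw [← h]
  refine D_congr (fun y hy => ?_) (Ioo_subset_Ioc_self hx)
  simp only [hf.D_smul k ha hy]
  ring

lemma MemH.sub {X Y : State} (hX : MemH a X) (hY : MemH a Y) : MemH a (X - Y) :=
  ⟨hX.1.sub hY.1, MemLp.sub hX.2 hY.2⟩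

lemma MemH.smul {X : State} (k : ℝ) (hX : MemH a X) : MemH a (k • X) :=
  ⟨hX.1.smul k, MemLp.const_smul hX.2 k⟩

lemma MemDomain.memH {X : State} (hX : MemDomain a β X) : MemH a X := ⟨hX.1.2, hX.2.1.1.memL2⟩

lemma MemDomain.memH_opA {X : State} (ha : Admissible a) (hX : MemDomain a β X) :
    MemH a (opA a X) := ⟨hX.2.1, hX.1.1.divForm_memL2 ha⟩

lemma MemDomain.sub {X Y : State} (ha : Admissible a) (hX : MemDomain a β X)
    (hY : MemDomain a β Y) : MemDomain a β (X - Y) := by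
  refine ⟨⟨hX.1.1.sub hY.1.1, hX.1.2.sub hY.1.2⟩, hX.2.1.sub hY.2.1, ?_⟩
  rw [Prod.fst_sub, Prod.snd_sub, hX.1.1.D_sub ha hY.1.1 ⟨one_pos, le_rfl⟩, Pi.sub_apply,
    Pi.sub_apply]
  linear_combination hX.2.2 - hY.2.2

lemma MemDomain.smul {X : State} (k : ℝ) (ha : Admissible a) (hX : MemDomain a β X) :
    MemDomain a β (k • X) := by
  refine ⟨⟨hX.1.1.smul k, hX.1.2.smul k⟩, hX.2.1.smul k, ?_⟩
  rw [Prod.smul_fst, Prod.smul_snd, hX.1.1.D_smul k ha ⟨one_pos, le_rfl⟩, Pi.smul_apply,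
    Pi.smul_apply, smul_eq_mul, smul_eq_mul]
  linear_combination k * hX.2.2

/-! ### The energy norm -/

lemma normSqH_eq (ha : Admissible a) {X : State} (hX : MemH a X) :
    normSqH a β X = (∫ x, X.2 x ^ 2 ∂unitMeas) + (∫ x, a x * D X.1 x ^ 2 ∂unitMeas)
      + a 1 * β * X.1 1 ^ 2 := by
  unfold normSqH
  rw [intervalIntegral_eq_unitMeas, integral_add hX.2.integrable_sq' (hX.1.1.integrable_energy ha)]

lemma energy_eq_normSqH (U : ℝ → State) (t : ℝ) :
    energy a β U t = 1 / 2 * normSqH a β (U t) := by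
  unfold energy normSqH
  ring

lemma integral_snd_sq_le (ha : Admissible a) (hβ : 0 < β) {X : State} (hX : MemH a X) :
    ∫ x, X.2 x ^ 2 ∂unitMeas ≤ normSqH a β X := by
  rw [normSqH_eq ha hX]
  have h1 := integral_energy_nonneg ha X.1
  have h2 : 0 ≤ a 1 * β * X.1 1 ^ 2 := by have := ha.one_pos'; positivity
  linarith

lemma integral_grad_sq_le (ha : Admissible a) (hβ : 0 < β) {X : State} (hX : MemH a X) :
    ∫ x, a x * D X.1 x ^ 2 ∂unitMeas ≤ normSqH a β X := by
  rw [normSqH_eq ha hX]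
  have h1 : 0 ≤ ∫ x, X.2 x ^ 2 ∂unitMeas := integral_nonneg fun x => sq_nonneg _
  have h2 : 0 ≤ a 1 * β * X.1 1 ^ 2 := by have := ha.one_pos'; positivity
  linarith

lemma trace_sq_le (ha : Admissible a) (hβ : 0 < β) {X : State} (hX : MemH a X) :
    X.1 1 ^ 2 ≤ (a 1 * β)⁻¹ * normSqH a β X := by
  have h0 : 0 < a 1 * β := mul_pos ha.one_pos' hβ
  rw [normSqH_eq ha hX, ← div_eq_inv_mul, le_div_iff₀ h0]
  have h1 : 0 ≤ ∫ x, X.2 x ^ 2 ∂unitMeas := integral_nonneg fun x => sq_nonneg _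
  have h2 := integral_energy_nonneg ha X.1
  linarith

lemma integral_fst_sq_le (ha : Admissible a) (hβ : 0 < β) {X : State} (hX : MemH a X) :
    ∫ x, X.1 x ^ 2 ∂unitMeas ≤ (constAlpha a β)⁻¹ * normSqH a β X := by
  have h0 := constAlpha_pos ha hβ
  rw [normSqH_eq ha hX, ← div_eq_inv_mul, le_div_iff₀ h0]
  have h1 : 0 ≤ ∫ x, X.2 x ^ 2 ∂unitMeas := integral_nonneg fun x => sq_nonneg _
  have h2 := hX.1.1.alpha_mul_integral_sq_le ha hβ
  linarith

/-! ### Differentiation of curves in `L²(0,1)` -/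

open Classical in
/-- The class in `L²(0,1)` of a function. -/
def toL2 (f : ℝ → ℝ) : Lp ℝ 2 unitMeas := if h : MemL2 f then MemLp.toLp f h else 0

lemma inner_toL2 {f g : ℝ → ℝ} (hf : MemL2 f) (hg : MemL2 g) :
    inner ℝ (toL2 f) (toL2 g) = ∫ x, f x * g x ∂unitMeas := by
  rw [L2.inner_def]
  refine integral_congr_ae ?_
  unfold toL2
  rw [dif_pos hf, dif_pos hg]
  filter_upwards [MemLp.coeFn_toLp hf, MemLp.coeFn_toLp hg] with x h1 h2
  rw [h1, h2]
  simp [mul_comm]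

lemma norm_toL2_sq {f : ℝ → ℝ} (hf : MemL2 f) : ‖toL2 f‖ ^ 2 = ∫ x, f x ^ 2 ∂unitMeas := by
  rw [← real_inner_self_eq_norm_sq, inner_toL2 hf hf]
  simp only [sq]

lemma toL2_sub {f g : ℝ → ℝ} (hf : MemL2 f) (hg : MemL2 g) :
    toL2 (f - g) = toL2 f - toL2 g := by
  have h : MemL2 (f - g) := MemLp.sub hf hg
  unfold toL2
  rw [dif_pos hf, dif_pos hg, dif_pos h]
  exact MemLp.toLp_sub hf hg

lemma toL2_smul {f : ℝ → ℝ} (k : ℝ) (hf : MemL2 f) : toL2 (k • f) = k • toL2 f := by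
  have h : MemL2 (k • f) := MemLp.const_smul hf k
  unfold toL2
  rw [dif_pos hf, dif_pos h]
  exact MemLp.toLp_const_smul k hf

lemma tendsto_zero_of_sq_le {l : Filter ℝ} {F N : ℝ → ℝ} (C : ℝ) (hN : Tendsto N l (𝓝 0))
    (h : ∀ᶠ s in l, F s ^ 2 ≤ C * N s) : Tendsto F l (𝓝 0) := by
  have h1 : Tendsto (fun s => F s ^ 2) l (𝓝 0) := by
    refine tendsto_of_tendsto_of_tendsto_of_le_of_le' tendsto_const_nhds
      (by simpa using hN.const_mul C) (Eventually.of_forall fun s => sq_nonneg _) h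
  have h2 := (Real.continuous_sqrt.tendsto 0).comp h1
  simp only [Real.sqrt_zero] at h2
  rw [tendsto_zero_iff_abs_tendsto_zero]
  refine h2.congr fun s => ?_
  simp [Real.sqrt_sq_eq_abs]

/-- Transfers differentiability from $\mathcal H_\beta$ to $L^2(0,1)$. In use, $N$ is the squared
energy norm of the difference quotient minus the derivative, and $C$ the continuity constant of the
component considered. -/
lemma hasDerivWithinAt_toL2 {F : ℝ → ℝ → ℝ} {f : ℝ → ℝ} {t : ℝ} (ht : 0 ≤ t)
    (hF : ∀ s, 0 ≤ s → MemL2 (F s)) (hf : MemL2 f) {N : ℝ → ℝ} (C : ℝ)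
    (hN : Tendsto N (𝓝[Ici 0 \ {t}] t) (𝓝 0))
    (h : ∀ s, 0 ≤ s → ∫ x, ((s - t)⁻¹ * (F s x - F t x) - f x) ^ 2 ∂unitMeas ≤ C * N s) :
    HasDerivWithinAt (fun s => toL2 (F s)) (toL2 f) (Ici 0) t := by
  rw [hasDerivWithinAt_iff_tendsto_slope, tendsto_iff_norm_sub_tendsto_zero]
  refine tendsto_zero_of_sq_le C hN ?_
  filter_upwards [self_mem_nhdsWithin] with s hs
  have hs0 : 0 ≤ s := hs.1
  have e : slope (fun s => toL2 (F s)) t s - toL2 f =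
      toL2 ((s - t)⁻¹ • (F s - F t) - f) := by
    rw [toL2_sub (MemLp.const_smul (MemLp.sub (hF s hs0) (hF t ht)) _) hf,
      toL2_smul _ (MemLp.sub (hF s hs0) (hF t ht)), toL2_sub (hF s hs0) (hF t ht),
      slope_def_module]
  rw [e, norm_toL2_sq (MemLp.sub (MemLp.const_smul (MemLp.sub (hF s hs0) (hF t ht)) _) hf)]
  exact h s hs0

lemma hasDerivWithinAt_pairing {F G : ℝ → ℝ → ℝ} {f g : ℝ → ℝ} {t : ℝ} (ht : 0 ≤ t)
    (hF : ∀ s, 0 ≤ s → MemL2 (F s)) (hG : ∀ s, 0 ≤ s → MemL2 (G s)) (hf : MemL2 f) (hg : MemL2 g)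
    (dF : HasDerivWithinAt (fun s => toL2 (F s)) (toL2 f) (Ici 0) t)
    (dG : HasDerivWithinAt (fun s => toL2 (G s)) (toL2 g) (Ici 0) t) :
    HasDerivWithinAt (fun s => ∫ x, F s x * G s x ∂unitMeas)
      ((∫ x, F t x * g x ∂unitMeas) + ∫ x, f x * G t x ∂unitMeas) (Ici 0) t := by
  have h := dF.inner ℝ dG
  rw [inner_toL2 (hF t ht) hg, inner_toL2 hf (hG t ht)] at h
  exact h.congr (fun s hs => (inner_toL2 (hF s hs) (hG s hs)).symm)
    (inner_toL2 (hF t ht) (hG t ht)).symm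

/-! ### Time derivatives of the components and of the trace of a curve in $\mathcal H_\beta$. -/

section Curves

variable {W Y : ℝ → State} {t : ℝ}

lemma ae_D_comb {f g h : ℝ → ℝ} (k : ℝ) (hf : LocAC f) (hg : LocAC g) (hh : LocAC h) :
    ∀ᵐ x ∂unitMeas, D (k • (f - g) - h) x = k * (D f x - D g x) - D h x := by
  have h1 : LocAC (fun x => f x - g x) := hf.sub hg
  filter_upwards [(h1.const_mul k).ae_D_sub hh, h1.ae_D_const_mul k, hf.ae_D_sub hg]
    with x e1 e2 e3
  have e : D (k • (f - g) - h) x = D (fun y => k * (f y - g y) - h y) x := rfl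
  rw [e, e1, e2, e3]

lemma hasDerivWithinAt_fst (ha : Admissible a) (hβ : 0 < β)
    (hW : ∀ s, 0 ≤ s → MemH a (W s)) (hY : ∀ s, 0 ≤ s → MemH a (Y s))
    (hd : HasDerivH a β W Y) (ht : 0 ≤ t) :
    HasDerivWithinAt (fun s => toL2 (W s).1) (toL2 (Y t).1) (Ici 0) t :=
  hasDerivWithinAt_toL2 ht (fun s hs => (hW s hs).1.1.memL2) (hY t ht).1.1.memL2
    (constAlpha a β)⁻¹ (hd t ht) fun s hs =>
    integral_fst_sq_le ha hβ ((((hW s hs).sub (hW t ht)).smul _).sub (hY t ht))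

lemma hasDerivWithinAt_snd (ha : Admissible a) (hβ : 0 < β)
    (hW : ∀ s, 0 ≤ s → MemH a (W s)) (hY : ∀ s, 0 ≤ s → MemH a (Y s))
    (hd : HasDerivH a β W Y) (ht : 0 ≤ t) :
    HasDerivWithinAt (fun s => toL2 (W s).2) (toL2 (Y t).2) (Ici 0) t :=
  hasDerivWithinAt_toL2 ht (fun s hs => (hW s hs).2) (hY t ht).2
    1 (hd t ht) fun s hs => by
    rw [one_mul]
    exact integral_snd_sq_le ha hβ ((((hW s hs).sub (hW t ht)).smul _).sub (hY t ht))

lemma hasDerivWithinAt_grad (ha : Admissible a) (hβ : 0 < β)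
    (hW : ∀ s, 0 ≤ s → MemH a (W s)) (hY : ∀ s, 0 ≤ s → MemH a (Y s))
    (hd : HasDerivH a β W Y) (ht : 0 ≤ t) :
    HasDerivWithinAt (fun s => toL2 (fun x => √(a x) * D (W s).1 x))
      (toL2 (fun x => √(a x) * D (Y t).1 x)) (Ici 0) t :=
  hasDerivWithinAt_toL2 ht (fun s hs => (hW s hs).1.1.deriv_memL2) (hY t ht).1.1.deriv_memL2
    1 (hd t ht) fun s hs => by
    rw [one_mul]
    refine le_trans (le_of_eq (integral_congr_ae ?_))
      (integral_grad_sq_le ha hβ ((((hW s hs).sub (hW t ht)).smul (s - t)⁻¹).sub (hY t ht)))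
    filter_upwards [ae_D_comb (s - t)⁻¹ (hW s hs).1.1.locAC (hW t ht).1.1.locAC
      (hY t ht).1.1.locAC, ae_sqrt_mul_sq ha (D ((s - t)⁻¹ • (W s - W t) - Y t).1)] with x h1 h2
    rw [← h2]
    have e : D ((s - t)⁻¹ • (W s - W t) - Y t).1 x = _ := h1
    rw [e]
    ring

lemma hasDerivWithinAt_mul_grad (ha : Admissible a) (hβ : 0 < β)
    (hW : ∀ s, 0 ≤ s → MemH a (W s)) (hY : ∀ s, 0 ≤ s → MemH a (Y s))
    (hd : HasDerivH a β W Y) (ht : 0 ≤ t) :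
    HasDerivWithinAt (fun s => toL2 (fun x => x * D (W s).1 x))
      (toL2 (fun x => x * D (Y t).1 x)) (Ici 0) t :=
  hasDerivWithinAt_toL2 ht (fun s hs => (hW s hs).1.1.memL2_mul_D ha)
    ((hY t ht).1.1.memL2_mul_D ha) (1 / a 1) (hd t ht) fun s hs => by
    have hZ := (((hW s hs).sub (hW t ht)).smul (s - t)⁻¹).sub (hY t ht)
    refine le_trans (le_of_eq (integral_congr_ae ?_)) ((hZ.1.1.integral_mul_D_sq_le ha).trans
      (mul_le_mul_of_nonneg_left (integral_grad_sq_le ha hβ hZ)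
        (one_div_nonneg.2 ha.one_pos'.le)))
    filter_upwards [ae_D_comb (s - t)⁻¹ (hW s hs).1.1.locAC (hW t ht).1.1.locAC
      (hY t ht).1.1.locAC] with x h1
    have e : D ((s - t)⁻¹ • (W s - W t) - Y t).1 x = _ := h1
    rw [e]
    ring

lemma hasDerivWithinAt_trace (ha : Admissible a) (hβ : 0 < β)
    (hW : ∀ s, 0 ≤ s → MemH a (W s)) (hY : ∀ s, 0 ≤ s → MemH a (Y s))
    (hd : HasDerivH a β W Y) (ht : 0 ≤ t) :
    HasDerivWithinAt (fun s => (W s).1 1) ((Y t).1 1) (Ici 0) t := by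
  rw [hasDerivWithinAt_iff_tendsto_slope, tendsto_iff_norm_sub_tendsto_zero]
  refine tendsto_zero_of_sq_le (a 1 * β)⁻¹ (hd t ht) ?_
  filter_upwards [self_mem_nhdsWithin] with s hs
  rw [Real.norm_eq_abs, sq_abs, slope_def_module]
  exact trace_sq_le ha hβ ((((hW s hs.1).sub (hW t ht)).smul (s - t)⁻¹).sub (hY t ht))

end Curves

end

section

/-! ### Abstract decay lemmas -/

/-- An integral inequality of Haraux–Komornik type yields exponential decay. -/
lemma exp_decay_of_integral_le {E : ℝ → ℝ} (hc : Continuous E) (hE : AntitoneOn E (Ici 0)) {M : ℝ}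
    (hM : 0 < M) (h : ∀ s T, 0 ≤ s → s ≤ T → ∫ r in s..T, E r ≤ M * E s) {t : ℝ} (ht : M ≤ t) :
    E t ≤ E 0 * Real.exp (1 - t / M) := by
  have ht0 : 0 ≤ t := hM.le.trans ht
  set G : ℝ → ℝ := fun s => ∫ r in s..t, E r with hG
  have hGd : ∀ s, HasDerivAt G (-E s) s := fun s =>
    intervalIntegral.integral_hasDerivAt_left (hc.intervalIntegrable s t)
      (hc.stronglyMeasurableAtFilter _ _) hc.continuousAt
  have hd : ∀ s, HasDerivAt (fun s => G s * Real.exp (s / M))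
      (-E s * Real.exp (s / M) + G s * (Real.exp (s / M) * (1 / M))) s := fun s =>
    (hGd s).mul (((hasDerivAt_id' s).div_const M).exp)
  -- The hypothesis reads $G\le-MG'$, so $G e^{s/M}$ is nonincreasing.
  have hanti : AntitoneOn (fun s => G s * Real.exp (s / M)) (Icc 0 t) := by
    refine antitoneOn_of_deriv_nonpos (convex_Icc 0 t)
      (fun s _ => (hd s).continuousAt.continuousWithinAt)
      (fun s _ => (hd s).differentiableAt.differentiableWithinAt) fun s hs => ?_
    rw [interior_Icc] at hs
    rw [(hd s).deriv]
    have h1 := h s t hs.1.le hs.2.le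
    have e : -E s * Real.exp (s / M) + G s * (Real.exp (s / M) * (1 / M)) =
        Real.exp (s / M) / M * (G s - M * E s) := by
      field_simp
      ring
    rw [e]
    exact mul_nonpos_of_nonneg_of_nonpos (by positivity) (by simp only [hG]; linarith)
  have h1 := hanti ⟨le_rfl, ht0⟩ ⟨by linarith, by linarith⟩ (by linarith : (0 : ℝ) ≤ t - M)
  simp only [zero_div, Real.exp_zero, mul_one] at h1
  have h2 : G 0 ≤ M * E 0 := h 0 t le_rfl ht0
  -- On the last window, of length $M$, monotonicity bounds $E$ below by $E(t)$. This window lies in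
  -- $[0,t]$ because $t\ge M$, and it produces the factor $e$ in the estimate.
  have h3 : M * E t ≤ G (t - M) := by
    have h4 : ∫ _ in (t - M)..t, E t ≤ ∫ r in (t - M)..t, E r := by
      refine intervalIntegral.integral_mono_on (by linarith) intervalIntegrable_const
        (hc.intervalIntegrable _ _) fun r hr => ?_
      exact hE (show (0 : ℝ) ≤ r by linarith [hr.1]) ht0 hr.2
    rw [intervalIntegral.integral_const, smul_eq_mul, sub_sub_cancel] at h4
    exact h4
  have h5 : M * E t * Real.exp ((t - M) / M) ≤ M * E 0 :=
    (mul_le_mul_of_nonneg_right h3 (Real.exp_pos _).le).trans (h1.trans h2)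
  have e1 : Real.exp (1 - t / M) * Real.exp ((t - M) / M) = 1 := by
    have e0 : 1 - t / M + (t - M) / M = 0 := by
      field_simp
      ring
    rw [← Real.exp_add, e0, Real.exp_zero]
  have h6 : E t * Real.exp ((t - M) / M) ≤ E 0 := by
    rw [mul_assoc] at h5
    exact le_of_mul_le_mul_left h5 hM
  calc E t = E t * Real.exp ((t - M) / M) * Real.exp (1 - t / M) := by
        rw [mul_assoc, mul_comm (Real.exp ((t - M) / M)), e1, mul_one]
    _ ≤ E 0 * Real.exp (1 - t / M) := mul_le_mul_of_nonneg_right h6 (Real.exp_pos _).le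

/-- Decay from a dissipation identity `E' = -d` and a multiplier functional `F`. -/
lemma exp_decay_of_lyapunov {E F d F' : ℝ → ℝ} {κ K c M : ℝ}
    (hE : ∀ t, 0 ≤ t → HasDerivWithinAt E (-d t) (Ici 0) t)
    (hF : ∀ t, 0 ≤ t → HasDerivWithinAt F (F' t) (Ici 0) t)
    (hE0 : ∀ t, 0 ≤ t → 0 ≤ E t) (hd : ∀ t, 0 ≤ t → 0 ≤ d t)
    (hF' : ∀ t, 0 ≤ t → F' t ≤ K * d t - κ * E t) (hFE : ∀ t, 0 ≤ t → |F t| ≤ c * E t)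
    (hκ : 0 < κ) (hK : 0 ≤ K) (hc : 0 ≤ c) (hM : 0 < M) (hle : 2 * c + K ≤ κ * M)
    {t : ℝ} (ht : M ≤ t) : E t ≤ E 0 * Real.exp (1 - t / M) := by
  have hcE : ContinuousOn E (Ici 0) := fun t ht => (hE t ht).continuousWithinAt
  have hcF : ContinuousOn F (Ici 0) := fun t ht => (hF t ht).continuousWithinAt
  have hdE : ∀ t ∈ Ioi (0 : ℝ), HasDerivAt E (-d t) t := fun t ht =>
    (hE t (le_of_lt ht)).hasDerivAt (Ici_mem_nhds ht)
  have hdF : ∀ t ∈ Ioi (0 : ℝ), HasDerivAt F (F' t) t := fun t ht =>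
    (hF t (le_of_lt ht)).hasDerivAt (Ici_mem_nhds ht)
  have hanti : AntitoneOn E (Ici 0) := by
    refine antitoneOn_of_deriv_nonpos (convex_Ici 0) hcE ?_ ?_ <;> rw [interior_Ici]
    · exact fun t ht => (hdE t ht).differentiableAt.differentiableWithinAt
    · intro t ht
      rw [(hdE t ht).deriv]
      linarith [hd t (le_of_lt ht)]
  -- Constant extension to negative times, so that the primitive of the energy is differentiable on
  -- all of $\mathbb R$.
  set Ê : ℝ → ℝ := fun t => E (max t 0) with hÊ
  have hÊc : Continuous Ê := hcE.comp_continuous (by fun_prop)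
    fun t => show (0 : ℝ) ≤ max t 0 from le_max_right _ _
  have hÊe : ∀ t, 0 ≤ t → Ê t = E t := fun t ht => by simp only [hÊ, max_eq_left ht]
  have hint : ∀ t, HasDerivAt (fun t => ∫ r in (0 : ℝ)..t, Ê r) (Ê t) t := fun t =>
    intervalIntegral.integral_hasDerivAt_right (hÊc.intervalIntegrable _ _)
      (hÊc.stronglyMeasurableAtFilter _ _) hÊc.continuousAt
  -- The derivative is $F'-Kd+\kappa E\le0$. Comparing $s$ and $T$ gives $\kappa\int_s^TE\le
  -- F(s)-F(T)+K(E(s)-E(T))\le(2c+K)E(s)$.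
  have hΦ : AntitoneOn (fun t => F t + K * E t + κ * ∫ r in (0 : ℝ)..t, Ê r) (Ici 0) := by
    have hder : ∀ t ∈ Ioi (0 : ℝ), HasDerivAt
        (fun t => F t + K * E t + κ * ∫ r in (0 : ℝ)..t, Ê r)
        (F' t + K * (-d t) + κ * Ê t) t := fun t ht =>
      ((hdF t ht).fun_add ((hdE t ht).const_mul K)).fun_add ((hint t).const_mul κ)
    refine antitoneOn_of_deriv_nonpos (convex_Ici 0) ?_ ?_ ?_
    · exact (hcF.add (continuousOn_const.mul hcE)).add (continuousOn_const.mul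
        fun t _ => (hint t).continuousAt.continuousWithinAt)
    · rw [interior_Ici]
      exact fun t ht => (hder t ht).differentiableAt.differentiableWithinAt
    · rw [interior_Ici]
      intro t ht
      have ht' : 0 ≤ t := le_of_lt ht
      rw [(hder t ht).deriv, hÊe t ht']
      linarith [hF' t ht']
  have hfin := exp_decay_of_integral_le hÊc (E := Ê) (fun s hs t ht hst => by
    rw [hÊe s hs, hÊe t ht]
    exact hanti hs ht hst) hM (fun s T hs hsT => by
    have hT : 0 ≤ T := hs.trans hsT
    have h1 := hΦ hs hT hsT
    simp only at h1
    have h2 : ∫ r in s..T, Ê r = (∫ r in (0 : ℝ)..T, Ê r) - ∫ r in (0 : ℝ)..s, Ê r :=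
      (intervalIntegral.integral_interval_sub_left (hÊc.intervalIntegrable _ _)
        (hÊc.intervalIntegrable _ _)).symm
    have h3 := abs_le.1 (hFE s hs)
    have h4 := abs_le.1 (hFE T hT)
    have h5 : E T ≤ E s := hanti hs hT hsT
    have h6 := mul_le_mul_of_nonneg_left h5 hc
    have h7 := mul_nonneg hK (hE0 T hT)
    have h8 := mul_le_mul_of_nonneg_right hle (hE0 s hs)
    rw [hÊe s hs, h2]
    have h9 : κ * ((∫ r in (0 : ℝ)..T, Ê r) - ∫ r in (0 : ℝ)..s, Ê r) ≤ κ * (M * E s) := by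
      linarith [h3.2, h4.1]
    exact le_of_mul_le_mul_left h9 hκ) ht
  rwa [hÊe t (hM.le.trans ht), hÊe 0 le_rfl] at hfin

/-! ### Rates of the functionals along the generator -/

variable {a u v : ℝ → ℝ} {β : ℝ}

lemma two_mul_abs_integral_mul_le {f g : ℝ → ℝ} (hf : MemL2 f) (hg : MemL2 g) :
    2 * |∫ x, f x * g x ∂unitMeas| ≤
      (∫ x, f x ^ 2 ∂unitMeas) + ∫ x, g x ^ 2 ∂unitMeas := by
  have h := integral_mul_sq_le hf hg
  have h1 : 0 ≤ ∫ x, f x ^ 2 ∂unitMeas := integral_nonneg fun x => sq_nonneg _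
  have h2 : 0 ≤ ∫ x, g x ^ 2 ∂unitMeas := integral_nonneg fun x => sq_nonneg _
  have h3 : |∫ x, f x * g x ∂unitMeas| ≤
      ((∫ x, f x ^ 2 ∂unitMeas) + ∫ x, g x ^ 2 ∂unitMeas) / 2 :=
    abs_le_of_sq_le_sq (by
      nlinarith [sq_nonneg ((∫ x, f x ^ 2 ∂unitMeas) - ∫ x, g x ^ 2 ∂unitMeas)]) (by linarith)
  linarith

lemma integral_flux_self (a u : ℝ → ℝ) : ∫ x, a x * D u x * D u x ∂unitMeas =
    ∫ x, a x * D u x ^ 2 ∂unitMeas := by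
  congr 1
  funext x
  ring

lemma MemDomain.trace_D {X : State} (hX : MemDomain a β X) :
    D X.1 1 = -(X.2 1 + β * X.1 1) := by
  linarith [hX.2.2]

/-- Green's formula tested with $v$, with $u'(1)$ eliminated by the boundary condition. The left
side is the time derivative of the energy along the generator. -/
lemma energy_rate (ha : Admissible a) (hX : MemDomain a β (u, v)) :
    (∫ x, divForm a u x * v x ∂unitMeas) + (∫ x, a x * D u x * D v x ∂unitMeas)
      + β * a 1 * u 1 * v 1 = -(a 1 * v 1 ^ 2) := by
  have h1 := green ha hX.1.1 hX.2.1
  have h2 : D u 1 = -(v 1 + β * u 1) := hX.trace_D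
  rw [h2] at h1
  linear_combination h1

/-- Half of the squared norm of a state. -/
def stateEnergy (a : ℝ → ℝ) (β : ℝ) (u v : ℝ → ℝ) : ℝ :=
  1 / 2 * ((∫ x, v x ^ 2 ∂unitMeas) + (∫ x, a x * D u x ^ 2 ∂unitMeas) + β * a 1 * u 1 ^ 2)

/-- The left side is half the time derivative of the multiplier functional. The weight $\mu_a/4$
balances the two energies: both $\int v^2$ and $\int a(u')^2$ end up with coefficient at most
$-(2-\mu_a)/4$. -/
lemma multiplier_rate (ha : Admissible a) (hX : MemDomain a β (u, v)) :
    (∫ x, x * D v x * v x ∂unitMeas) + (∫ x, x * D u x * divForm a u x ∂unitMeas)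
      + muA a / 4 * ((∫ x, v x ^ 2 ∂unitMeas) + ∫ x, divForm a u x * u x ∂unitMeas) ≤
    1 / 2 * constEta1 a * v 1 ^ 2 + 1 / 2 * a 1 * constEta2 a β * u 1 ^ 2
      - (2 - muA a) / 2 * stateEnergy a β u v := by
  have h1 := green ha hX.1.1 hX.1.2
  have h2 : D u 1 = -(v 1 + β * u 1) := hX.trace_D
  have h3 := integral_mul_D_mul_self ha hX.2.1.1
  have h4 := integral_mul_D_mul_divForm ha hX.1.1
  have h5 := integral_mul_D_coeff_le ha hX.1.1.1
  simp only at h1 h3 h4 h5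
  rw [integral_flux_self, h2] at h1
  rw [h2] at h4
  rw [h3, h4, show ∫ x, divForm a u x * u x ∂unitMeas =
    a 1 * -(v 1 + β * u 1) * u 1 - ∫ x, a x * D u x ^ 2 ∂unitMeas by linarith]
  unfold stateEnergy constEta1 constEta2
  -- Young's inequality for the mixed term $u(1)v(1)$. It is the origin of the $\frac32$ in $\eta_1$
  -- and of the squared term in $\eta_2$.
  have h6 : 0 ≤ a 1 * ((2 * β - muA a / 2) * u 1 - v 1) ^ 2 :=
    mul_nonneg ha.one_pos'.le (sq_nonneg _)
  nlinarith

/-- Green's formula tested with $\zeta$, combined with the identity defining $\zeta$, turns the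
pairing into $-a(1)\zeta(1)v(1)-u(1)$. This produces the negative $u(1)^2$ that the dissipation
lacks. -/
lemma corrector_rate (ha : Admissible a) (hX : MemDomain a β (u, v)) {ζ : ℝ → ℝ}
    (hζ : MemW1 a ζ) (h : ∀ u : ℝ → ℝ, MemW1 a u →
      (∫ x, a x * D u x * D ζ x ∂unitMeas) + β * a 1 * u 1 * ζ 1 = u 1) :
    u 1 * ∫ x, divForm a u x * ζ x ∂unitMeas = -(a 1 * ζ 1 * u 1 * v 1) - u 1 ^ 2 := by
  have h1 := green ha hX.1.1 hζ
  have h2 : D u 1 = -(v 1 + β * u 1) := hX.trace_D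
  have h3 := h u hX.1.2
  simp only at h1
  rw [h2] at h1
  linear_combination u 1 * h1 - u 1 * h3

lemma stateEnergy_nonneg (ha : Admissible a) (hβ : 0 < β) (u v : ℝ → ℝ) :
    0 ≤ stateEnergy a β u v := by
  have h1 : 0 ≤ ∫ x, v x ^ 2 ∂unitMeas := integral_nonneg fun x => sq_nonneg _
  have h2 := integral_energy_nonneg ha u
  have h3 := ha.one_pos'
  unfold stateEnergy
  positivity

/-- After Young and Poincaré, the three entries of the maximum in $C_a''$ bound the coefficients of
$\int v^2$, $\int a(u')^2$ and $u(1)^2$ respectively. -/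
lemma abs_multiplier_le (ha : Admissible a) (hβ : 0 < β) (hu : MemV1 a u) (hv : MemL2 v) :
    |2 * (∫ x, x * D u x * v x ∂unitMeas) + muA a / 2 * ∫ x, v x * u x ∂unitMeas| ≤
      constC'' a β * stateEnergy a β u v := by
  have h1 := two_mul_abs_integral_mul_le (hu.memL2_mul_D ha) hv
  have h2 := two_mul_abs_integral_mul_le hv hu.memL2
  have h3 := hu.integral_mul_D_sq_le ha
  have h4 := hu.integral_sq_le ha
  have hμ := ha.mu_nonneg
  have ha1 := ha.one_pos'
  have hA : 0 ≤ ∫ x, v x ^ 2 ∂unitMeas := integral_nonneg fun x => sq_nonneg _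
  have hB := integral_energy_nonneg ha u
  have hC := sq_nonneg (u 1)
  refine (abs_add_le _ _).trans ?_
  rw [abs_mul, abs_mul, abs_two, abs_of_nonneg (by positivity : 0 ≤ muA a / 2)]
  have h2' := mul_le_mul_of_nonneg_left h2 (by positivity : 0 ≤ muA a / 4)
  have h4' := mul_le_mul_of_nonneg_left h4 (by positivity : 0 ≤ muA a / 4)
  unfold constC'' stateEnergy
  set m := max (1 + muA a / 4)
    (max (1 / a 1 + muA a / 4 * constC' a) (muA a / (2 * β * a 1))) with hm
  have m1 : 1 + muA a / 4 ≤ m := le_max_left _ _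
  have m2 : 1 / a 1 + muA a / 4 * constC' a ≤ m := (le_max_left _ _).trans (le_max_right _ _)
  have m3 : muA a / (2 * β * a 1) ≤ m := (le_max_right _ _).trans (le_max_right _ _)
  have m3' : muA a / 2 ≤ m * (β * a 1) := by
    rw [div_le_iff₀ (by positivity)] at m3
    linarith
  have k1 := mul_le_mul_of_nonneg_right m1 hA
  have k2 := mul_le_mul_of_nonneg_right m2 hB
  have k3 := mul_le_mul_of_nonneg_right m3' hC
  linarith

lemma corrector_pairing_sq_le (ha : Admissible a) (hβ : 0 < β) {ζ : ℝ → ℝ} (hζ : MemW1 a ζ)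
    (h : ∀ u : ℝ → ℝ, MemW1 a u →
      (∫ x, a x * D u x * D ζ x ∂unitMeas) + β * a 1 * u 1 * ζ 1 = u 1) (hv : MemL2 v) :
    constAlpha a β * (β * a 1) * (∫ x, v x * ζ x ∂unitMeas) ^ 2 ≤ ∫ x, v x ^ 2 ∂unitMeas := by
  have h1 := integral_mul_sq_le hv hζ.1.memL2
  have h2 := (corrector_bounds ha hβ hζ h).2.2
  have hA : 0 ≤ ∫ x, v x ^ 2 ∂unitMeas := integral_nonneg fun x => sq_nonneg _
  have hα := constAlpha_pos ha hβ
  have ha1 := ha.one_pos'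
  have h3 := mul_le_mul_of_nonneg_left h1 (by positivity : 0 ≤ constAlpha a β * (β * a 1))
  have h4 := mul_le_mul_of_nonneg_left h2 hA
  linarith

/-- By the preceding Cauchy–Schwarz bound, the square of $a(1)\beta\sqrt{\alpha_a}\,u(1)\int v\zeta$
is at most $\beta a(1)u(1)^2\int v^2$, which the arithmetic–geometric inequality bounds by $E^2$. -/
lemma abs_corrector_le (ha : Admissible a) (hβ : 0 < β) {ζ : ℝ → ℝ} (hζ : MemW1 a ζ)
    (h : ∀ u : ℝ → ℝ, MemW1 a u →
      (∫ x, a x * D u x * D ζ x ∂unitMeas) + β * a 1 * u 1 * ζ 1 = u 1) (hv : MemL2 v) :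
    a 1 * |u 1 * ∫ x, v x * ζ x ∂unitMeas| ≤
      1 / (β * √(constAlpha a β)) * stateEnergy a β u v := by
  have h1 := corrector_pairing_sq_le ha hβ hζ h hv
  have hα := constAlpha_pos ha hβ
  have hs := Real.sqrt_pos.2 hα
  have hs2 := Real.sq_sqrt hα.le
  have ha1 := ha.one_pos'
  have hE := stateEnergy_nonneg ha hβ u v
  have hA : 0 ≤ ∫ x, v x ^ 2 ∂unitMeas := integral_nonneg fun x => sq_nonneg _
  have hB := integral_energy_nonneg ha u
  rw [div_mul_eq_mul_div, one_mul, le_div_iff₀ (by positivity)]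
  set I := ∫ x, v x * ζ x ∂unitMeas with hI
  set A := ∫ x, v x ^ 2 ∂unitMeas with hAdef
  have hlow : 1 / 2 * (A + β * a 1 * u 1 ^ 2) ≤ stateEnergy a β u v := by
    unfold stateEnergy
    linarith
  have hk : 0 ≤ β * a 1 * u 1 ^ 2 := by positivity
  have hsq : (a 1 * (u 1 * I) * (β * √(constAlpha a β))) ^ 2 ≤ stateEnergy a β u v ^ 2 := by
    have e : (a 1 * (u 1 * I) * (β * √(constAlpha a β))) ^ 2 =
        β * a 1 * u 1 ^ 2 * (constAlpha a β * (β * a 1) * I ^ 2) := by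
      linear_combination (a 1 ^ 2 * u 1 ^ 2 * I ^ 2 * β ^ 2) * hs2
    rw [e]
    have k1 := mul_le_mul_of_nonneg_left h1 hk
    have k2 := pow_le_pow_left₀ (by positivity) hlow 2
    nlinarith [sq_nonneg (A - β * a 1 * u 1 ^ 2)]
  have h2 := abs_le_of_sq_le_sq hsq hE
  rwa [abs_mul, abs_mul, abs_of_pos ha1, abs_of_pos (by positivity : 0 < β * √(constAlpha a β))]
    at h2

/-- The Young-type estimate for the boundary terms produced by the corrector. -/
lemma corrector_remainder_le (ha : Admissible a) (hβ : 0 < β) {ζ : ℝ → ℝ} (hζ : MemW1 a ζ)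
    (h : ∀ u : ℝ → ℝ, MemW1 a u →
      (∫ x, a x * D u x * D ζ x ∂unitMeas) + β * a 1 * u 1 * ζ 1 = u 1) (hv : MemL2 v) (η : ℝ) :
    a 1 * η * (v 1 * ((∫ x, v x * ζ x ∂unitMeas) - a 1 * ζ 1 * u 1)) ≤
      (2 - muA a) / 2 * stateEnergy a β u v
      + η ^ 2 * (1 + 1 / β ^ 3) / (2 - muA a) * (1 + 1 / (β * constAlpha a β)) *
        (a 1 * v 1 ^ 2) := by
  have h1 := corrector_pairing_sq_le ha hβ hζ h hv
  obtain ⟨z0, z1, -⟩ := corrector_bounds ha hβ hζ h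
  have hα := constAlpha_pos ha hβ
  have ha1 := ha.one_pos'
  have hB := integral_energy_nonneg ha u
  have hm : 0 < 2 - muA a := by linarith [ha.mu_lt_two]
  set I := ∫ x, v x * ζ x ∂unitMeas with hI
  set A := ∫ x, v x ^ 2 ∂unitMeas with hAdef
  set α := constAlpha a β
  set m := 2 - muA a
  have hlow : 1 / 2 * (α * (β * a 1) * I ^ 2 + β * a 1 * u 1 ^ 2) ≤ stateEnergy a β u v := by
    unfold stateEnergy
    linarith
  have hE := mul_le_mul_of_nonneg_left hlow (by positivity : 0 ≤ m / 2)
  set b := 1 / β ^ 3 with hb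
  have hb0 : 0 < b := by positivity
  have hbβ : b * β ^ 3 = 1 := by
    rw [hb]
    field_simp
  set q := 1 / (β * α) with hq
  have hqα : q * (β * α) = 1 := by
    rw [hq]
    field_simp
  have hq0 : 0 < q := by positivity
  -- Young's inequality is applied with weight $1/(1+b)$ here and $b/(1+b)$ in `y2`, so both
  -- dissipation constants share the factor $1+b$. The choice $b=\beta^{-3}$ makes the second square
  -- exact. The weights are afterwards bounded by $1$.
  have y1 : a 1 * η * (v 1 * I) ≤ m / 4 * (1 / (1 + b)) * (α * (β * a 1) * I ^ 2)
      + η ^ 2 / m * (q * (1 + b)) * (a 1 * v 1 ^ 2) := by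
    have e : m / 4 * (1 / (1 + b)) * (α * (β * a 1) * I ^ 2)
      + η ^ 2 / m * (q * (1 + b)) * (a 1 * v 1 ^ 2) - a 1 * η * (v 1 * I) =
      a 1 / (4 * m * (1 + b) * q) * (m * I - 2 * η * (1 + b) * q * v 1) ^ 2 := by
      have hαe : α = 1 / (q * β) := by
        rw [eq_div_iff (by positivity)]
        linarith
      rw [hαe]
      field_simp
      ring
    have : 0 ≤ a 1 / (4 * m * (1 + b) * q) * (m * I - 2 * η * (1 + b) * q * v 1) ^ 2 := by
      positivity
    linarith
  have y2 : -(a 1 * η * (v 1 * (a 1 * ζ 1 * u 1))) ≤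
      m / 4 * (b / (1 + b)) * (β * a 1 * u 1 ^ 2)
      + η ^ 2 / m * (1 + b) * (a 1 * v 1 ^ 2) := by
    have z2 : (β * a 1 * ζ 1) ^ 2 ≤ 1 := by
      have z3 : 0 ≤ β * a 1 * ζ 1 := by positivity
      exact pow_le_one₀ z3 z1
    have e : m / 4 * (b / (1 + b)) * (β * a 1 * u 1 ^ 2)
      + η ^ 2 / m * (1 + b) * ((β * a 1 * ζ 1) ^ 2 * (a 1 * v 1 ^ 2))
      + a 1 * η * (v 1 * (a 1 * ζ 1 * u 1)) =
      a 1 / (4 * m * (1 + b) * β ^ 2) *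
        (m * u 1 + 2 * η * (1 + b) * β ^ 2 * (a 1 * ζ 1) * v 1) ^ 2 := by
      have hbe : b = 1 / β ^ 3 := hb
      have h1b : 0 < 1 + b := by positivity
      have e1 : m / 4 * (b / (1 + b)) * (β * a 1 * u 1 ^ 2) =
          a 1 / (4 * m * (1 + b) * β ^ 2) * (m * u 1) ^ 2 := by
        have : b * β = 1 / β ^ 2 := by
          rw [hbe]
          field_simp
        calc m / 4 * (b / (1 + b)) * (β * a 1 * u 1 ^ 2)
            = m / 4 * (1 / (1 + b)) * (b * β) * (a 1 * u 1 ^ 2) := by ring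
          _ = m / 4 * (1 / (1 + b)) * (1 / β ^ 2) * (a 1 * u 1 ^ 2) := by rw [this]
          _ = _ := by field_simp
      rw [e1]
      field_simp
      ring
    have h0 : 0 ≤ a 1 / (4 * m * (1 + b) * β ^ 2) *
        (m * u 1 + 2 * η * (1 + b) * β ^ 2 * (a 1 * ζ 1) * v 1) ^ 2 := by
      positivity
    have h2 : η ^ 2 / m * (1 + b) * ((β * a 1 * ζ 1) ^ 2 * (a 1 * v 1 ^ 2)) ≤
        η ^ 2 / m * (1 + b) * (1 * (a 1 * v 1 ^ 2)) := by gcongr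
    linarith
  have hθ1 : m / 4 * (1 / (1 + b)) * (α * (β * a 1) * I ^ 2) ≤
      m / 4 * (α * (β * a 1) * I ^ 2) := by
    have : 1 / (1 + b) ≤ 1 := by
      rw [div_le_one (by positivity)]
      linarith
    calc m / 4 * (1 / (1 + b)) * (α * (β * a 1) * I ^ 2)
        ≤ m / 4 * 1 * (α * (β * a 1) * I ^ 2) := by gcongr
      _ = _ := by ring
  have hθ2 : m / 4 * (b / (1 + b)) * (β * a 1 * u 1 ^ 2) ≤ m / 4 * (β * a 1 * u 1 ^ 2) := by
    have : b / (1 + b) ≤ 1 := by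
      rw [div_le_one (by positivity)]
      linarith
    calc m / 4 * (b / (1 + b)) * (β * a 1 * u 1 ^ 2)
        ≤ m / 4 * 1 * (β * a 1 * u 1 ^ 2) := by gcongr
      _ = _ := by ring
  have e : η ^ 2 * (1 + b) / m * (1 + q) * (a 1 * v 1 ^ 2) =
      η ^ 2 / m * (q * (1 + b)) * (a 1 * v 1 ^ 2) + η ^ 2 / m * (1 + b) * (a 1 * v 1 ^ 2) := by
    ring
  rw [e]
  linarith

end

section

variable {a : ℝ → ℝ} {β : ℝ}

/-! ### The decay time -/

lemma two_le_constC'' (ha : Admissible a) (β : ℝ) : 2 ≤ constC'' a β := by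
  have h1 : 1 + muA a / 4 ≤ max (1 + muA a / 4)
    (max (1 / a 1 + muA a / 4 * constC' a) (muA a / (2 * β * a 1))) := le_max_left _ _
  have := ha.mu_nonneg
  unfold constC''
  linarith

lemma constEta1_div_pos (ha : Admissible a) : 0 < constEta1 a / a 1 := by
  have h := ha.one_pos'
  unfold constEta1
  positivity

/-- Since $1/\beta\le1+1/\beta^3$ and $2-\mu_a\le2$, the sum is at least
$\frac12y^2+2y=\frac12(y+2)^2-2$ with $y=\eta/(\beta\sqrt{\alpha_a})$. This controls the last term
of $M_{a,\beta}$ when $\eta_2<0$; as $2C_a''\ge4$, it also gives $M_{a,\beta}>0$. -/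
lemma neg_two_le_eta_terms (ha : Admissible a) (hβ : 0 < β) (η : ℝ) :
    -2 ≤ η ^ 2 * (1 + 1 / β ^ 3) / (2 - muA a) * (1 + 1 / (β * constAlpha a β))
      + 2 * η / (β * √(constAlpha a β)) := by
  have hα := constAlpha_pos ha hβ
  have hs := Real.sqrt_pos.2 hα
  have hs2 := Real.sq_sqrt hα.le
  have hm : 0 < 2 - muA a := by linarith [ha.mu_lt_two]
  have hm2 : 2 - muA a ≤ 2 := by linarith [ha.mu_nonneg]
  set s := √(constAlpha a β) with hsdef
  rw [← hs2]
  have h1 : 1 / β ≤ 1 + 1 / β ^ 3 := by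
    rcases le_total 1 β with h | h
    · have h2 : 1 / β ≤ 1 := by rwa [div_le_one hβ]
      have h3 : 0 < 1 / β ^ 3 := by positivity
      linarith
    · have h2 : 1 / β ≤ 1 / β ^ 3 :=
        one_div_le_one_div_of_le (by positivity) (pow_le_of_le_one hβ.le h three_ne_zero)
      linarith
  have h2 : η ^ 2 / 2 * (1 / β) * (1 / (β * s ^ 2)) ≤
      η ^ 2 * (1 + 1 / β ^ 3) / (2 - muA a) * (1 + 1 / (β * s ^ 2)) := by
    have k1 : 1 / (β * s ^ 2) ≤ 1 + 1 / (β * s ^ 2) := by linarith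
    have k2 : η ^ 2 / 2 * (1 / β) ≤ η ^ 2 * (1 + 1 / β ^ 3) / (2 - muA a) := by
      calc η ^ 2 / 2 * (1 / β) = η ^ 2 * (1 / β) / 2 := by ring
        _ ≤ η ^ 2 * (1 + 1 / β ^ 3) / (2 - muA a) := by gcongr
    exact mul_le_mul k2 k1 (by positivity) (by positivity)
  have h3 : η ^ 2 / 2 * (1 / β) * (1 / (β * s ^ 2)) + 2 * η / (β * s) + 2 =
      1 / 2 * (η / (β * s) + 2) ^ 2 := by
    field_simp
    ring
  have h4 : 0 ≤ 1 / 2 * (η / (β * s) + 2) ^ 2 := by positivity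
  linarith

lemma mul_constM (ha : Admissible a) (β : ℝ) : (2 - muA a) / 2 * constM a β =
    2 * constC'' a β + constEta1 a / a 1
      + (constEta2 a β ^ 2 * (1 + 1 / β ^ 3) / (2 - muA a) * (1 + 1 / (β * constAlpha a β))
      + 2 * constEta2 a β / (β * √(constAlpha a β))) := by
  have hm : 0 < 2 - muA a := by linarith [ha.mu_lt_two]
  unfold constM
  rw [← mul_assoc, show (2 - muA a) / 2 * (2 / (2 - muA a)) = 1 by field_simp, one_mul]
  ring

lemma constM_pos (ha : Admissible a) (hβ : 0 < β) : 0 < constM a β := by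
  have hm : 0 < (2 - muA a) / 2 := by linarith [ha.mu_lt_two]
  have h1 := two_le_constC'' ha β
  have h2 := constEta1_div_pos ha
  have h3 := neg_two_le_eta_terms ha hβ (constEta2 a β)
  have h4 := mul_constM ha β
  have h5 : 0 < (2 - muA a) / 2 * constM a β := by
    rw [h4]
    linarith
  exact pos_of_mul_pos_right h5 hm.le

/-! ### Classical solutions -/

/-- A classical solution: a curve in `D(A_β)`, differentiable in `ℋ_β`, with `W' = A_β W`. -/
def IsClassicalSolution (a : ℝ → ℝ) (β : ℝ) (W : ℝ → State) : Prop :=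
  (∀ t, 0 ≤ t → MemDomain a β (W t)) ∧ HasDerivH a β W (fun t => opA a (W t))

namespace IsClassicalSolution

variable {W : ℝ → State} {t : ℝ}

lemma hasDerivWithinAt_energy (ha : Admissible a) (hβ : 0 < β) (hW : IsClassicalSolution a β W)
    (ht : 0 ≤ t) : HasDerivWithinAt (fun s => stateEnergy a β (W s).1 (W s).2)
      (-(a 1 * (W t).2 1 ^ 2)) (Ici 0) t := by
  have mH : ∀ s, 0 ≤ s → MemH a (W s) := fun s hs => (hW.1 s hs).memH
  have mY : ∀ s, 0 ≤ s → MemH a (opA a (W s)) := fun s hs => (hW.1 s hs).memH_opA ha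
  have dv := hasDerivWithinAt_snd ha hβ mH mY hW.2 ht
  have dg := hasDerivWithinAt_grad ha hβ mH mY hW.2 ht
  have d1 := hasDerivWithinAt_trace ha hβ mH mY hW.2 ht
  have pv := hasDerivWithinAt_pairing ht (fun s hs => (mH s hs).2) (fun s hs => (mH s hs).2)
    (mY t ht).2 (mY t ht).2 dv dv
  have pg := hasDerivWithinAt_pairing ht (fun s hs => (mH s hs).1.1.deriv_memL2)
    (fun s hs => (mH s hs).1.1.deriv_memL2) (mY t ht).1.1.deriv_memL2
    (mY t ht).1.1.deriv_memL2 dg dg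
  have hall := (((pv.fun_add pg).fun_add ((d1.fun_mul d1).const_mul (β * a 1))).const_mul (1 / 2))
  have hr := energy_rate ha (hW.1 t ht)
  have e1 : ∫ x, (W t).2 x * (opA a (W t)).2 x ∂unitMeas =
      ∫ x, divForm a (W t).1 x * (W t).2 x ∂unitMeas := by
    congr 1
    funext x
    exact mul_comm _ _
  have e2 : ∫ x, √(a x) * D (W t).1 x * (√(a x) * D (opA a (W t)).1 x) ∂unitMeas =
      ∫ x, a x * D (W t).1 x * D (W t).2 x ∂unitMeas := by
    refine integral_congr_ae ?_
    filter_upwards [ae_unitMeas_mem] with x hx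
    have := Real.mul_self_sqrt (ha.pos x (Ioo_subset_Ioc_self hx)).le
    have e : D (opA a (W t)).1 x = D (W t).2 x := rfl
    rw [e]
    linear_combination (D (W t).1 x * D (W t).2 x) * this
  have e3 : ∫ x, √(a x) * D (opA a (W t)).1 x * (√(a x) * D (W t).1 x) ∂unitMeas =
      ∫ x, a x * D (W t).1 x * D (W t).2 x ∂unitMeas := by
    rw [← e2]
    congr 1
    funext x
    exact mul_comm _ _
  have e4 : ∫ x, (opA a (W t)).2 x * (W t).2 x ∂unitMeas =
      ∫ x, divForm a (W t).1 x * (W t).2 x ∂unitMeas := rfl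
  have e5 : (opA a (W t)).1 1 = (W t).2 1 := rfl
  rw [e1, e2, e3, e4, e5] at hall
  have hval : 1 / 2 * ((∫ x, divForm a (W t).1 x * (W t).2 x ∂unitMeas)
      + (∫ x, divForm a (W t).1 x * (W t).2 x ∂unitMeas)
      + ((∫ x, a x * D (W t).1 x * D (W t).2 x ∂unitMeas)
        + ∫ x, a x * D (W t).1 x * D (W t).2 x ∂unitMeas)
      + β * a 1 * ((W t).2 1 * (W t).1 1 + (W t).1 1 * (W t).2 1)) =
      -(a 1 * (W t).2 1 ^ 2) := by
    linear_combination hr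
  rw [hval] at hall
  have hfun : ∀ s, stateEnergy a β (W s).1 (W s).2 =
      1 / 2 * ((∫ x, (W s).2 x * (W s).2 x ∂unitMeas)
        + (∫ x, √(a x) * D (W s).1 x * (√(a x) * D (W s).1 x) ∂unitMeas)
        + β * a 1 * ((W s).1 1 * (W s).1 1)) := fun s => by
    have : ∫ x, √(a x) * D (W s).1 x * (√(a x) * D (W s).1 x) ∂unitMeas =
        ∫ x, a x * D (W s).1 x ^ 2 ∂unitMeas := by
      refine integral_congr_ae ?_
      filter_upwards [ae_sqrt_mul_sq ha (D (W s).1)] with x h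
      rw [← h, sq]
    rw [this]
    unfold stateEnergy
    simp only [sq]
  exact hall.congr (fun s _ => hfun s) (hfun t)

/-- Derivative of the multiplier functional `2 ∫ x u' v + (μ_a / 2) ∫ u v`. -/
lemma hasDerivWithinAt_multiplier (ha : Admissible a) (hβ : 0 < β)
    (hW : IsClassicalSolution a β W) (ht : 0 ≤ t) : HasDerivWithinAt
      (fun s => 2 * (∫ x, x * D (W s).1 x * (W s).2 x ∂unitMeas)
        + muA a / 2 * ∫ x, (W s).2 x * (W s).1 x ∂unitMeas)
      (2 * ((∫ x, x * D (W t).2 x * (W t).2 x ∂unitMeas)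
        + (∫ x, x * D (W t).1 x * divForm a (W t).1 x ∂unitMeas)
        + muA a / 4 * ((∫ x, (W t).2 x ^ 2 ∂unitMeas)
          + ∫ x, divForm a (W t).1 x * (W t).1 x ∂unitMeas))) (Ici 0) t := by
  have mH : ∀ s, 0 ≤ s → MemH a (W s) := fun s hs => (hW.1 s hs).memH
  have mY : ∀ s, 0 ≤ s → MemH a (opA a (W s)) := fun s hs => (hW.1 s hs).memH_opA ha
  have dv := hasDerivWithinAt_snd ha hβ mH mY hW.2 ht
  have du := hasDerivWithinAt_fst ha hβ mH mY hW.2 ht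
  have dx := hasDerivWithinAt_mul_grad ha hβ mH mY hW.2 ht
  have p1 := hasDerivWithinAt_pairing ht (fun s hs => (mH s hs).1.1.memL2_mul_D ha)
    (fun s hs => (mH s hs).2) ((mY t ht).1.1.memL2_mul_D ha) (mY t ht).2 dx dv
  have p2 := hasDerivWithinAt_pairing ht (fun s hs => (mH s hs).2)
    (fun s hs => (mH s hs).1.1.memL2) (mY t ht).2 (mY t ht).1.1.memL2 dv du
  have hall := (p1.const_mul 2).fun_add (p2.const_mul (muA a / 2))
  have e : ∫ x, (W t).2 x * (opA a (W t)).1 x ∂unitMeas = ∫ x, (W t).2 x ^ 2 ∂unitMeas := by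
    congr 1
    funext x
    exact (sq _).symm
  have e1 : ∫ x, x * D (W t).1 x * (opA a (W t)).2 x ∂unitMeas =
      ∫ x, x * D (W t).1 x * divForm a (W t).1 x ∂unitMeas := rfl
  have e2 : ∫ x, x * D (opA a (W t)).1 x * (W t).2 x ∂unitMeas =
      ∫ x, x * D (W t).2 x * (W t).2 x ∂unitMeas := rfl
  have e3 : ∫ x, (opA a (W t)).2 x * (W t).1 x ∂unitMeas =
      ∫ x, divForm a (W t).1 x * (W t).1 x ∂unitMeas := rfl
  rw [e, e1, e2, e3] at hall
  refine hall.congr_deriv ?_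
  ring

lemma hasDerivWithinAt_corrector (ha : Admissible a) (hβ : 0 < β)
    (hW : IsClassicalSolution a β W) {ζ : ℝ → ℝ} (hζ : MemL2 ζ) (ht : 0 ≤ t) : HasDerivWithinAt
      (fun s => (W s).1 1 * ∫ x, (W s).2 x * ζ x ∂unitMeas)
      ((W t).2 1 * (∫ x, (W t).2 x * ζ x ∂unitMeas)
        + (W t).1 1 * ∫ x, divForm a (W t).1 x * ζ x ∂unitMeas) (Ici 0) t := by
  have mH : ∀ s, 0 ≤ s → MemH a (W s) := fun s hs => (hW.1 s hs).memH
  have mY : ∀ s, 0 ≤ s → MemH a (opA a (W s)) := fun s hs => (hW.1 s hs).memH_opA ha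
  have dv := hasDerivWithinAt_snd ha hβ mH mY hW.2 ht
  have d1 := hasDerivWithinAt_trace ha hβ mH mY hW.2 ht
  have hz : MemL2 (fun _ : ℝ => (0 : ℝ)) := memLp_const 0
  have dz : HasDerivWithinAt (fun _ : ℝ => toL2 ζ) (toL2 fun _ => 0) (Ici 0) t := by
    have : toL2 (fun _ => 0) = 0 := by
      have h := norm_toL2_sq hz
      simpa using h
    rw [this]
    exact hasDerivWithinAt_const _ _ _
  have p := hasDerivWithinAt_pairing ht (fun s hs => (mH s hs).2) (fun s _ => hζ)
    (mY t ht).2 hz dv dz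
  have hall := d1.fun_mul p
  have e1 : (opA a (W t)).1 1 = (W t).2 1 := rfl
  have e2 : ∫ x, (opA a (W t)).2 x * ζ x ∂unitMeas =
      ∫ x, divForm a (W t).1 x * ζ x ∂unitMeas := rfl
  rw [e1, e2] at hall
  refine hall.congr_deriv ?_
  simp

/-- Exponential decay of classical solutions. -/
lemma decay (ha : Admissible a) (hβ : 0 < β) (hW : IsClassicalSolution a β W)
    (ht : constM a β ≤ t) : stateEnergy a β (W t).1 (W t).2 ≤
      stateEnergy a β (W 0).1 (W 0).2 * Real.exp (1 - t / constM a β) := by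
  obtain ⟨ζ, hζ, hζe⟩ := exists_corrector ha hβ
  have hM := constM_pos ha hβ
  have hC := two_le_constC'' ha β
  have hη1 := constEta1_div_pos ha
  have hMeq := mul_constM ha β
  have ha1 := ha.one_pos'
  have hα := constAlpha_pos ha hβ
  have hm : 0 < 2 - muA a := by linarith [ha.mu_lt_two]
  have hη1e : ∀ y : ℝ, constEta1 a * y = constEta1 a / a 1 * (a 1 * y) := fun y => by
    field_simp
  have hd : ∀ t, 0 ≤ t → 0 ≤ a 1 * (W t).2 1 ^ 2 := fun t _ => by positivity
  have hF : ∀ t : ℝ, 0 ≤ t → _ := fun t ht => hW.hasDerivWithinAt_multiplier ha hβ ht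
  have hFE : ∀ t : ℝ, 0 ≤ t → _ := fun t ht =>
    abs_multiplier_le ha hβ (hW.1 t ht).1.1.1 (hW.1 t ht).2.1.1.memL2
  have hrate : ∀ t : ℝ, 0 ≤ t → _ := fun t ht => multiplier_rate ha (hW.1 t ht)
  -- For $\eta_2\ge0$ the corrector is needed, at the price of halving the rate to
  -- $\kappa=(2-\mu_a)/2$, and then $2c+K=\kappa M_{a,\beta}$ exactly. For $\eta_2<0$ the full rate
  -- is kept, and this factor two absorbs the possibly negative terms of $M_{a,\beta}$.
  rcases le_or_gt 0 (constEta2 a β) with hη | hη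
  · have hF2 : ∀ t : ℝ, 0 ≤ t → _ := fun t ht =>
      (hF t ht).fun_add ((hW.hasDerivWithinAt_corrector ha hβ hζ.1.memL2 ht).const_mul
        (a 1 * constEta2 a β))
    refine exp_decay_of_lyapunov (d := fun t => a 1 * (W t).2 1 ^ 2) (κ := (2 - muA a) / 2)
      (K := constEta1 a / a 1 + constEta2 a β ^ 2 * (1 + 1 / β ^ 3) / (2 - muA a)
        * (1 + 1 / (β * constAlpha a β)))
      (c := constC'' a β + constEta2 a β * (1 / (β * √(constAlpha a β))))
      (fun t ht => hW.hasDerivWithinAt_energy ha hβ ht) hF2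
      (fun t _ => stateEnergy_nonneg ha hβ _ _) hd (fun t ht => ?_) (fun t ht => ?_)
      (by linarith) (by positivity) (by positivity) hM ?_ ht
    · have h1 := hrate t ht
      have h2 := corrector_rate ha (hW.1 t ht) hζ hζe
      have h3 := corrector_remainder_le (u := (W t).1) ha hβ hζ hζe (hW.1 t ht).2.1.1.memL2
        (constEta2 a β)
      have h4 := hη1e ((W t).2 1 ^ 2)
      have h5 := congrArg (fun y => a 1 * constEta2 a β * y) h2
      linarith
    · refine (abs_add_le _ _).trans ?_
      have h1 := hFE t ht
      have h2 := mul_le_mul_of_nonneg_left (abs_corrector_le (u := (W t).1) ha hβ hζ hζe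
        (hW.1 t ht).2.1.1.memL2) hη
      rw [abs_mul (a 1 * constEta2 a β), abs_of_nonneg (mul_nonneg ha1.le hη)]
      linarith
    · rw [hMeq]
      apply le_of_eq
      ring
  · refine exp_decay_of_lyapunov (d := fun t => a 1 * (W t).2 1 ^ 2) (κ := 2 - muA a)
      (K := constEta1 a / a 1) (c := constC'' a β)
      (fun t ht => hW.hasDerivWithinAt_energy ha hβ ht) hF
      (fun t _ => stateEnergy_nonneg ha hβ _ _) hd (fun t ht => ?_) (fun t ht => hFE t ht)
      hm hη1.le (by linarith) hM ?_ ht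
    · have h1 := hrate t ht
      have h4 := hη1e ((W t).2 1 ^ 2)
      have h5 : a 1 * constEta2 a β * (W t).1 1 ^ 2 ≤ 0 :=
        mul_nonpos_of_nonpos_of_nonneg (mul_nonpos_of_nonneg_of_nonpos ha1.le hη.le)
          (sq_nonneg _)
      linarith
    · have h3 := neg_two_le_eta_terms ha hβ (constEta2 a β)
      linarith

end IsClassicalSolution

/-! ### Regularization in time -/

lemma normSqH_smul (ha : Admissible a) (k : ℝ) {X : State} (hX : MemH a X) :
    normSqH a β (k • X) = k ^ 2 * normSqH a β X := by
  rw [normSqH_eq ha (hX.smul k), normSqH_eq ha hX]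
  have e1 : ∫ x, (k • X).2 x ^ 2 ∂unitMeas = k ^ 2 * ∫ x, X.2 x ^ 2 ∂unitMeas := by
    rw [← integral_const_mul]
    congr 1
    funext x
    exact mul_pow _ _ _
  have e2 : ∫ x, a x * D (k • X).1 x ^ 2 ∂unitMeas =
      k ^ 2 * ∫ x, a x * D X.1 x ^ 2 ∂unitMeas := by
    rw [← integral_const_mul]
    refine integral_congr_ae ?_
    filter_upwards [hX.1.1.locAC.ae_D_const_mul k] with x h
    have h' : D (k • X).1 x = k * D X.1 x := h
    rw [h']
    ring
  have e3 : (k • X).1 1 = k * X.1 1 := rfl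
  rw [e1, e2, e3]
  ring

lemma sub_sq_le_weighted {ε : ℝ} (hε : 0 < ε) (x y : ℝ) :
    (x - y) ^ 2 ≤ (1 + ε) * x ^ 2 + (1 + ε⁻¹) * y ^ 2 := by
  have h : (1 + ε) * x ^ 2 + (1 + ε⁻¹) * y ^ 2 - (x - y) ^ 2 = ε⁻¹ * (ε * x + y) ^ 2 := by
    field_simp
    ring
  have : 0 ≤ ε⁻¹ * (ε * x + y) ^ 2 := by positivity
  linarith

/-- A weighted triangle inequality for squared norms: letting the error $Y$ vanish and then
$\varepsilon\to0$ recovers the constant $1$. -/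
lemma normSqH_sub_le (ha : Admissible a) (hβ : 0 < β) {ε : ℝ} (hε : 0 < ε) {X Y : State}
    (hX : MemH a X) (hY : MemH a Y) :
    normSqH a β (X - Y) ≤ (1 + ε) * normSqH a β X + (1 + ε⁻¹) * normSqH a β Y := by
  rw [normSqH_eq ha (hX.sub hY), normSqH_eq ha hX, normSqH_eq ha hY]
  have e1 : ∫ x, (X - Y).2 x ^ 2 ∂unitMeas ≤
      (1 + ε) * (∫ x, X.2 x ^ 2 ∂unitMeas) + (1 + ε⁻¹) * ∫ x, Y.2 x ^ 2 ∂unitMeas := by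
    rw [← integral_comb₂ hX.2.integrable_sq' hY.2.integrable_sq']
    exact integral_mono (hX.sub hY).2.integrable_sq'
      ((hX.2.integrable_sq'.const_mul _).add (hY.2.integrable_sq'.const_mul _))
      fun x => sub_sq_le_weighted hε _ _
  have e2 : ∫ x, a x * D (X - Y).1 x ^ 2 ∂unitMeas ≤
      (1 + ε) * (∫ x, a x * D X.1 x ^ 2 ∂unitMeas)
        + (1 + ε⁻¹) * ∫ x, a x * D Y.1 x ^ 2 ∂unitMeas := by
    have h1 := hX.1.1.integrable_energy ha
    have h2 := hY.1.1.integrable_energy ha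
    rw [← integral_comb₂ h1 h2]
    refine integral_mono_ae ((hX.sub hY).1.1.integrable_energy ha)
      ((h1.const_mul _).add (h2.const_mul _)) ?_
    filter_upwards [hX.1.1.locAC.ae_D_sub hY.1.1.locAC, ae_unitMeas_mem] with x h hx
    have h' : D (X - Y).1 x = D X.1 x - D Y.1 x := h
    rw [h']
    have := mul_le_mul_of_nonneg_left (sub_sq_le_weighted hε (D X.1 x) (D Y.1 x))
      (ha.pos x (Ioo_subset_Ioc_self hx)).le
    linarith
  have e3 : (X - Y).1 1 = X.1 1 - Y.1 1 := rfl
  have e4 := mul_le_mul_of_nonneg_left (sub_sq_le_weighted hε (X.1 1) (Y.1 1))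
    (mul_nonneg ha.one_pos'.le hβ.le)
  rw [e3]
  linarith

lemma normSqH_nonneg (ha : Admissible a) (hβ : 0 < β) {X : State} (hX : MemH a X) :
    0 ≤ normSqH a β X :=
  (integral_nonneg fun _ => sq_nonneg _).trans (integral_snd_sq_le ha hβ hX)

/-- The first component must agree pointwise on $(0,1]$, since its trace at $1$ and its derivative
enter the norm; for the second, almost everywhere suffices. -/
lemma normSqH_congr {X Y : State} (h1 : EqOn X.1 Y.1 (Ioc 0 1)) (h2 : EqAE X.2 Y.2) :
    normSqH a β X = normSqH a β Y := by
  unfold normSqH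
  rw [intervalIntegral_eq_unitMeas, intervalIntegral_eq_unitMeas, h1 ⟨one_pos, le_rfl⟩]
  congr 1
  refine integral_congr_ae ?_
  filter_upwards [h2, ae_unitMeas_mem] with x hx hx1
  rw [hx, D_congr h1 (Ioo_subset_Ioc_self hx1)]

lemma eqOn_of_eqAE {f g : ℝ → ℝ} (hf : LocAC f) (hg : LocAC g) (h : EqAE f g) :
    EqOn f g (Ioc 0 1) :=
  Measure.eqOn_Ioc_of_ae_eq (μ := volume)
    (by rwa [← Measure.restrict_congr_set (Ioo_ae_eq_Ioc (μ := volume) (a := (0 : ℝ)) (b := 1))])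
    hf.continuousOn hg.continuousOn

/-- Averages in time of a mild solution are classical solutions. -/
lemma isClassicalSolution_average (ha : Admissible a) (hβ : 0 < β) {U₀ : State}
    {U P : ℝ → State} (hU : ∀ t, 0 ≤ t → MemH a (U t)) (hP : HasDerivH a β P U)
    (hPU : ∀ t, 0 ≤ t → MemDomain a β (P t) ∧ EqH (U t - U₀) (opA a (P t))) {h : ℝ}
    (hh : 0 < h) : IsClassicalSolution a β (fun t => h⁻¹ • (P (t + h) - P t)) := by
  have hmem : ∀ t, 0 ≤ t → MemDomain a β (h⁻¹ • (P (t + h) - P t)) := fun t ht =>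
    ((hPU (t + h) (by linarith)).1.sub ha (hPU t ht).1).smul h⁻¹ ha
  refine ⟨hmem, fun t ht => ?_⟩
  -- The error of the difference quotient of $P$ at $r$. The corresponding error for the average is
  -- $h^{-1}$ times the difference of two such errors.
  set Q : ℝ → ℝ → State := fun r s => (s - r)⁻¹ • (P s - P r) - U r with hQ
  have hQm : ∀ r, 0 ≤ r → ∀ s, 0 ≤ s → MemH a (Q r s) := fun r hr s hs =>
    (((hPU s hs).1.memH.sub (hPU r hr).1.memH).smul _).sub (hU r hr)
  have hth : 0 ≤ t + h := by linarith
  have hlim1 : Tendsto (fun s => normSqH a β (Q (t + h) (s + h))) (𝓝[Ici 0 \ {t}] t) (𝓝 0) := by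
    refine (hP (t + h) hth).comp ?_
    refine tendsto_nhdsWithin_iff.2 ⟨?_, ?_⟩
    · exact ((continuous_id.add continuous_const).tendsto t).mono_left nhdsWithin_le_nhds
    · filter_upwards [self_mem_nhdsWithin] with s hs
      have hs0 : 0 ≤ s := hs.1
      exact ⟨show (0 : ℝ) ≤ s + h by linarith, fun h1 => hs.2 (add_right_cancel h1)⟩
  have hlim2 : Tendsto (fun s => normSqH a β (Q t s)) (𝓝[Ici 0 \ {t}] t) (𝓝 0) := hP t ht
  have hlim : Tendsto (fun s => h⁻¹ ^ 2 * ((1 + 1) * normSqH a β (Q (t + h) (s + h))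
      + (1 + 1⁻¹) * normSqH a β (Q t s))) (𝓝[Ici 0 \ {t}] t) (𝓝 0) := by
    have := ((hlim1.const_mul (1 + 1)).add (hlim2.const_mul (1 + 1⁻¹))).const_mul (h⁻¹ ^ 2)
    simpa using this
  -- Subtracting the mild identities at $t+h$ and $t$ removes $U_0$, so $h^{-1}(U(t+h)-U(t))$ is
  -- $A_\beta$ applied to the average; the first component is treated next.
  have heq2 : EqAE (h⁻¹ • (U (t + h) - U t)).2 (opA a (h⁻¹ • (P (t + h) - P t))).2 := by
    have hd1 := (hPU (t + h) hth).1.1.1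
    have hd2 := (hPU t ht).1.1.1
    filter_upwards [(hPU (t + h) hth).2.2, (hPU t ht).2.2,
      (hd1.sub hd2).ae_divForm_smul h⁻¹ ha, hd1.ae_divForm_sub ha hd2] with x h1 h2 h3 h4
    have h1' : (U (t + h)).2 x - U₀.2 x = divForm a (P (t + h)).1 x := h1
    have h2' : (U t).2 x - U₀.2 x = divForm a (P t).1 x := h2
    have h3' : (opA a (h⁻¹ • (P (t + h) - P t))).2 x =
      h⁻¹ * divForm a ((P (t + h)).1 - (P t).1) x := h3
    have e : (h⁻¹ • (U (t + h) - U t)).2 x = h⁻¹ * ((U (t + h)).2 x - (U t).2 x) := rfl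
    rw [e, h3', h4]
    linear_combination h⁻¹ * (h1' - h2')
  have heq1 : EqOn (h⁻¹ • (U (t + h) - U t)).1 (opA a (h⁻¹ • (P (t + h) - P t))).1
      (Ioc 0 1) := by
    refine eqOn_of_eqAE (((hU _ hth).sub (hU t ht)).smul h⁻¹).1.1.locAC
      (hmem t ht).2.1.1.locAC ?_
    filter_upwards [(hPU (t + h) hth).2.1, (hPU t ht).2.1] with x h1 h2
    have h1' : (U (t + h)).1 x - U₀.1 x = (P (t + h)).2 x := h1
    have h2' : (U t).1 x - U₀.1 x = (P t).2 x := h2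
    have e : (h⁻¹ • (U (t + h) - U t)).1 x = h⁻¹ * ((U (t + h)).1 x - (U t).1 x) := rfl
    have e' : (opA a (h⁻¹ • (P (t + h) - P t))).1 x = h⁻¹ * ((P (t + h)).2 x - (P t).2 x) := rfl
    rw [e, e']
    linear_combination h⁻¹ * (h1' - h2')
  refine tendsto_of_tendsto_of_tendsto_of_le_of_le' tendsto_const_nhds hlim ?_ ?_
  · filter_upwards [self_mem_nhdsWithin] with s hs
    exact normSqH_nonneg ha hβ ((((hmem s hs.1).memH.sub (hmem t ht).memH).smul _).sub
      ((hmem t ht).memH_opA ha))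
  · filter_upwards [self_mem_nhdsWithin] with s hs
    have hs0 : 0 ≤ s := hs.1
    have hsh : 0 ≤ s + h := by linarith
    have m1 := hQm (t + h) hth (s + h) hsh
    have m2 := hQm t ht s hs0
    have e : normSqH a β ((s - t)⁻¹ • (h⁻¹ • (P (s + h) - P s) - h⁻¹ • (P (t + h) - P t))
        - opA a (h⁻¹ • (P (t + h) - P t))) =
        normSqH a β (h⁻¹ • (Q (t + h) (s + h) - Q t s)) := by
      have e0 : h⁻¹ • (Q (t + h) (s + h) - Q t s) =
          (s - t)⁻¹ • (h⁻¹ • (P (s + h) - P s) - h⁻¹ • (P (t + h) - P t))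
            - h⁻¹ • (U (t + h) - U t) := by
        simp only [hQ, add_sub_add_right_eq_sub]
        module
      rw [e0]
      refine normSqH_congr (fun x hx => ?_) ?_
      · have := heq1 hx
        simp only [Prod.fst_sub, Pi.sub_apply] at this ⊢
        rw [this]
      · filter_upwards [heq2] with x hx
        simp only [Prod.snd_sub, Pi.sub_apply] at hx ⊢
        rw [hx]
    rw [e, normSqH_smul ha _ (m1.sub m2)]
    exact mul_le_mul_of_nonneg_left (normSqH_sub_le ha hβ one_pos m1 m2) (sq_nonneg _)

lemma stateEnergy_eq_normSqH (ha : Admissible a) {X : State} (hX : MemH a X) :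
    stateEnergy a β X.1 X.2 = 1 / 2 * normSqH a β X := by
  rw [normSqH_eq ha hX]
  unfold stateEnergy
  ring

/-- Exponential decay of the energy norm along mild solutions. -/
lemma IsMildSolution.normSqH_decay (ha : Admissible a) (hβ : 0 < β) {U₀ : State}
    {U : ℝ → State} (hU : IsMildSolution a β U₀ U) {t : ℝ} (ht : constM a β ≤ t) :
    normSqH a β (U t) ≤ normSqH a β (U 0) * Real.exp (1 - t / constM a β) := by
  obtain ⟨hm, -, P, -, hP, hPU⟩ := hU
  have ht0 : 0 ≤ t := (constM_pos ha hβ).le.trans ht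
  set r := Real.exp (1 - t / constM a β) with hr
  have hr0 : 0 < r := Real.exp_pos _
  have hlim : ∀ s, 0 ≤ s → Tendsto (fun h => normSqH a β (h⁻¹ • (P (s + h) - P s) - U s))
      (𝓝[>] 0) (𝓝 0) := fun s hs => by
    have h1 : Tendsto (fun h => s + h) (𝓝[>] 0) (𝓝[Ici 0 \ {s}] s) := by
      refine tendsto_nhdsWithin_iff.2 ⟨?_, ?_⟩
      · have h2 : Tendsto (fun h : ℝ => s + h) (𝓝 0) (𝓝 (s + 0)) :=
          (continuous_const.add continuous_id).tendsto 0
        rw [add_zero] at h2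
        exact h2.mono_left nhdsWithin_le_nhds
      · filter_upwards [self_mem_nhdsWithin] with h hh
        have hh' : 0 < h := hh
        refine ⟨show (0 : ℝ) ≤ s + h by linarith, fun h1 => ?_⟩
        have h2 : s + h = s := h1
        linarith
    refine ((hP s hs).comp h1).congr fun h => ?_
    simp only [Function.comp_apply, add_sub_cancel_left]
  -- One factor $1+\varepsilon$ comes from replacing $U(t)$ by its average, the other from replacing
  -- the average at time $0$ by $U(0)$. The $\varepsilon^{-1}$ errors vanish as $h\downarrow0$ with
  -- $\varepsilon$ fixed.
  have key : ∀ ε : ℝ, 0 < ε →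
      normSqH a β (U t) ≤ (1 + ε) * ((1 + ε) * normSqH a β (U 0) * r) := fun ε hε => by
    have hev : ∀ᶠ h in 𝓝[>] (0 : ℝ), normSqH a β (U t) ≤
        (1 + ε) * (((1 + ε) * normSqH a β (U 0)
          + (1 + ε⁻¹) * normSqH a β (h⁻¹ • (P (0 + h) - P 0) - U 0)) * r)
          + (1 + ε⁻¹) * normSqH a β (h⁻¹ • (P (t + h) - P t) - U t) := by
      filter_upwards [self_mem_nhdsWithin] with h hh
      have hW := isClassicalSolution_average ha hβ hm hP hPU hh
      have hWm : ∀ s, 0 ≤ s → MemH a (h⁻¹ • (P (s + h) - P s)) := fun s hs => (hW.1 s hs).memH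
      have h1 := hW.decay ha hβ ht
      rw [stateEnergy_eq_normSqH ha (hWm t ht0),
        stateEnergy_eq_normSqH ha (hWm 0 le_rfl), mul_assoc] at h1
      have h2 := le_of_mul_le_mul_left h1 one_half_pos
      have h3 := normSqH_sub_le (β := β) ha hβ hε (hWm t ht0) ((hWm t ht0).sub (hm t ht0))
      rw [sub_sub_cancel] at h3
      have h4 := normSqH_sub_le (β := β) ha hβ hε (hm 0 le_rfl)
        (((hWm 0 le_rfl).sub (hm 0 le_rfl)).smul (-1))
      rw [normSqH_smul ha _ ((hWm 0 le_rfl).sub (hm 0 le_rfl)), neg_one_smul, sub_neg_eq_add,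
        add_sub_cancel] at h4
      have h5 : normSqH a β (h⁻¹ • (P (t + h) - P t)) ≤ ((1 + ε) * normSqH a β (U 0)
          + (1 + ε⁻¹) * normSqH a β (h⁻¹ • (P (0 + h) - P 0) - U 0)) * r := by
        refine h2.trans (mul_le_mul_of_nonneg_right ?_ hr0.le)
        linarith
      have h6 := mul_le_mul_of_nonneg_left h5 (by linarith : (0 : ℝ) ≤ 1 + ε)
      linarith
    have hl := ((((hlim 0 le_rfl).const_mul (1 + ε⁻¹)).const_add
      ((1 + ε) * normSqH a β (U 0))).mul_const r).const_mul (1 + ε)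
    have hl2 := hl.add ((hlim t ht0).const_mul (1 + ε⁻¹))
    simp only [mul_zero, add_zero] at hl2
    exact ge_of_tendsto hl2 hev
  have hε : Tendsto (fun ε : ℝ => (1 + ε) * ((1 + ε) * normSqH a β (U 0) * r)) (𝓝[>] 0)
      (𝓝 ((1 + 0) * ((1 + 0) * normSqH a β (U 0) * r))) := by
    have hc : Continuous fun ε : ℝ => (1 + ε) * ((1 + ε) * normSqH a β (U 0) * r) := by fun_prop
    exact (hc.tendsto 0).mono_left nhdsWithin_le_nhds
  have := ge_of_tendsto hε (by
    filter_upwards [self_mem_nhdsWithin] with ε h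
    exact key ε h)
  simpa using this

end

end DegenerateWave

end

theorem mainTheorem6 (a : ℝ → ℝ) (ha : DegenerateWave.Admissible a) (β : ℝ) (hβ : 0 < β) :
    0 < DegenerateWave.constM a β ∧
      ∀ (U₀ : DegenerateWave.State) (U : ℝ → DegenerateWave.State),
        DegenerateWave.MemH a U₀ → DegenerateWave.IsMildSolution a β U₀ U →
          ∀ t : ℝ, DegenerateWave.constM a β ≤ t →
            DegenerateWave.energy a β U t ≤
              DegenerateWave.energy a β U 0 * Real.exp (1 - t / DegenerateWave.constM a β) := by
  refine ⟨DegenerateWave.constM_pos ha hβ, fun U₀ U _ hU t ht => ?_⟩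
  rw [DegenerateWave.energy_eq_normSqH, DegenerateWave.energy_eq_normSqH, mul_assoc]
  exact mul_le_mul_of_nonneg_left (hU.normSqH_decay ha hβ ht) one_half_pos.le
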